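/- Let $(X,\mu)$ and $(Y,\nu)$ be non-atomic Lebesgue (standard Borel) probability spaces, and let $\{R^z\}_{z\in\mathbb Z^2}$ and $\{T^z\}_{z\in\mathbb Z^2}$ be measure-preserving $\mathbb Z^2$-actions on $(X,\mu)$ and $(Y,\nu)$. Write $\hat S^z f = f\circ S^z$ for the operators induced by an action on the complex space $L_2$, $I$ for the identity operator, $\Theta$ for the orthogonal projection of $L_2$ onto the constants, and $L_2^0$ for the orthogonal complement of the constants. The symmetric square $\hat S^z\odot\hat S^z$ is the restriction of $\hat S^z\otimes\hat S^z$ to the space of symmetric functions $g(x,y)=g(y,x)$ in $L_2$ of the Cartesian square; it has *simple spectrum* if the space of symmetric functions orthogonal to the constants is the closed linear span of the orbit $\{(\hat S^z\otimes\hat S^z)h\}_{z\in\mathbb Z^2}$ of a single vector $h$. Suppose that the product action $\{R^z\times R^z\times T^z\times T^z\}_{z\in\mathbb Z^2}$ on $(X\times X\times Y\times Y,\ \mu\times\mu\times\nu\times\nu)$ is totally ergodic, i.e. each of its elements with $z\neq 0$ is ergodic. Suppose further that 1. the symmetric squares $\{\hat R^z\odot\hat R^z\}_{z\in\mathbb Z^2}$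 and $\{\hat T^z\odot\hat T^z\}_{z\in\mathbb Z^2}$ have simple spectrum; 2. for some sequences $w_i,u_i\in\mathbb Z^2$ and some numbers $a_1,a_2,b_1,b_2>0$ one has, in the weak operator topology as $i\to\infty$, $$\hat R^{w_i}\to a_1 I+(1-a_1)\Theta,\qquad \hat T^{w_i}\to b_1\hat T^{(1,0)}+(1-b_1)\Theta,$$ $$\hat R^{u_i}\to a_2 I+(1-a_2)\Theta,\qquad \hat T^{u_i}\to b_2\hat T^{(0,1)}+(1-b_2)\Theta.$$ Then the action $\{R^z\times R^z\times T^z\times T^z\}_{z\in\mathbb Z^2}$ has set of spectral multiplicities $\{2,4\}$ on $L_2^0$: the space $L_2^0(X\times X\times Y\times Y)$ is the orthogonal sum of two nonzero closed invariant subspaces $P_2$ and $P_4$ such that there is no nonzero bounded operator between $P_2$ and $P_4$ (in either direction) intertwining the restrictions of the action, and, for $n\in\{2,4\}$, $P_n$ is the orthogonal sum of $n$ cyclic subspaces (closed linear spans of orbits of single vectors) on which the restrictions of the action are pairwise unitarily isomorphic. -/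

import Mathlib

open MeasureTheory Filter Topology

noncomputable section

/-! ### Unitary families indexed by `ℤ × ℤ`: cyclic subspaces, homogeneous spectrum, multiplicities -/

section Spectral

variable {H : Type*} [NormedAddCommGroup H] [InnerProductSpace ℂ H]

/-- The closed linear span of the orbit `U z h`, `z ∈ ℤ²`. -/
def cyclicSpan (U : ℤ × ℤ → H →L[ℂ] H) (h : H) : Submodule ℂ H :=
  (Submodule.span ℂ (Set.range fun z => U z h)).topologicalClosure

/-- `C` is a cyclic subspace: the closed linear span of the orbit of some vector. -/
def IsCyclicSubspace (U : ℤ × ℤ → H →L[ℂ] H) (C : Submodule ℂ H) : Prop :=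
  ∃ h : H, cyclicSpan U h = C

/-- A bounded operator `J : K → L` between invariant subspaces intertwines the restrictions of `U`:
`J (U z x) = U z (J x)` for `x ∈ K`. -/
def Intertwines (U : ℤ × ℤ → H →L[ℂ] H) {K L : Submodule ℂ H} (J : K →L[ℂ] L) : Prop :=
  ∀ (z : ℤ × ℤ) (x y : K), (y : H) = U z (x : H) → (J y : H) = U z (J x : H)

/-- The restrictions of `U` to the invariant subspaces `K` and `L` are unitarily isomorphic. -/
def RestrictionsIsomorphic (U : ℤ × ℤ → H →L[ℂ] H) (K L : Submodule ℂ H) : Prop :=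
  ∃ Φ : K ≃ₗᵢ[ℂ] L, Intertwines U (Φ.toContinuousLinearEquiv : K →L[ℂ] L)

/-- The restrictions of `U` to the invariant subspaces `K` and `L` are (spectrally) disjoint:
there is no nonzero intertwining operator. -/
def RestrictionsDisjoint (U : ℤ × ℤ → H →L[ℂ] H) (K L : Submodule ℂ H) : Prop :=
  ∀ J : K →L[ℂ] L, Intertwines U J → J = 0

/-- The restriction of `U` to `K` has homogeneous spectrum of multiplicity `n ∈ {1, 2, …, ∞}`:
`K` is the orthogonal Hilbert sum of `n` cyclic subspaces on which the restrictions of `U` are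
isomorphic to each other. -/
def HasHomogeneousSpectrum (U : ℤ × ℤ → H →L[ℂ] H) (K : Submodule ℂ H) (n : ℕ∞) : Prop :=
  1 ≤ n ∧
  ∃ C : {i : ℕ // (i : ℕ∞) < n} → Submodule ℂ H,
    (∀ i, IsCyclicSubspace U (C i)) ∧
    (Pairwise fun i j => C i ⟂ C j) ∧
    (⨆ i, C i).topologicalClosure = K ∧
    ∀ i j, RestrictionsIsomorphic U (C i) (C j)

/-- The restriction of `U` to `K` has set of spectral multiplicities `M ⊆ {1, 2, …, ∞}`:
`K` is the orthogonal Hilbert sum of nonzero, pairwise disjoint parts `P n`, `n ∈ M`, where `P n`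
has homogeneous spectrum of multiplicity `n`.  Equivalently, `M` is the set of essential values of
the spectral multiplicity function. -/
def HasMultiplicitySet (U : ℤ × ℤ → H →L[ℂ] H) (K : Submodule ℂ H) (M : Set ℕ∞) : Prop :=
  ∃ P : M → Submodule ℂ H,
    (∀ n, P n ≠ ⊥) ∧
    (∀ n, HasHomogeneousSpectrum U (P n) n) ∧
    (Pairwise fun m n => P m ⟂ P n) ∧
    (Pairwise fun m n => RestrictionsDisjoint U (P m) (P n)) ∧
    (⨆ n, P n).topologicalClosure = K

/-- Convergence of a sequence of operators in the weak operator topology. -/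
def WeakOperatorTendsto (A : ℕ → H →L[ℂ] H) (B : H →L[ℂ] H) : Prop :=
  ∀ f g : H, Tendsto (fun i => inner ℂ (A i f) g) atTop (𝓝 (inner ℂ (B f) g))

end Spectral

/-! ### Constants in `L²` -/

section Constants

variable {X : Type*} [MeasurableSpace X] (μ : Measure X) [IsProbabilityMeasure μ]

/-- The subspace of constants in `L²(X, μ)`. -/
def constSubspace : Submodule ℂ (Lp ℂ 2 μ) :=
  Submodule.span ℂ {Lp.const 2 μ (1 : ℂ)}

instance : FiniteDimensional ℂ (constSubspace μ) := by
  unfold constSubspace; infer_instance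

/-- The orthogonal projection `Θ` onto the constants. -/
def constProj : Lp ℂ 2 μ →L[ℂ] Lp ℂ 2 μ :=
  (constSubspace μ).starProjection

/-- `L²₀(X, μ)`, the orthogonal complement of the constants. -/
def L2Zero : Submodule ℂ (Lp ℂ 2 μ) :=
  (constSubspace μ)ᗮ

/-- The subspace of functions `g ∈ L²(X × X, μ × μ)` with `g(x, y) = g(y, x)`,
that is, the symmetric tensor square of `L²(X, μ)`. -/
def symmSubspace : Submodule ℂ (Lp ℂ 2 (μ.prod μ)) :=
  LinearMap.eqLocus
    (Lp.compMeasurePreservingₗᵢ ℂ (Prod.swap : X × X → X × X)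
      (Measure.measurePreserving_swap (μ := μ) (ν := μ))).toLinearMap
    LinearMap.id

end Constants

/-! ### Measure-preserving `ℤ²`-actions -/

/-- A measure-preserving `ℤ²`-action on `(X, μ)`; as usual for automorphisms of a measure space,
the group law is understood modulo null sets. -/
structure Z2Action {X : Type*} [MeasurableSpace X] (μ : Measure X) where
  /-- the transformation `S^z` -/
  map : ℤ × ℤ → X → X
  measurePreserving : ∀ z, MeasurePreserving (map z) μ μ
  map_zero : map 0 =ᵐ[μ] id
  map_add : ∀ z₁ z₂, map z₁ ∘ map z₂ =ᵐ[μ] map (z₁ + z₂)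

namespace Z2Action

variable {X Y : Type*} [MeasurableSpace X] [MeasurableSpace Y] {μ : Measure X} {ν : Measure Y}

/-- The operators `(Ŝ^z f)(x) = f(S^z x)` on `L²(X, μ)`. -/
def koopman (S : Z2Action μ) (z : ℤ × ℤ) : Lp ℂ 2 μ →L[ℂ] Lp ℂ 2 μ :=
  (Lp.compMeasurePreservingₗᵢ ℂ (S.map z) (S.measurePreserving z)).toContinuousLinearMap

/-- The diagonal product action `S^z × T^z` on `(X × Y, μ × ν)`; its operators are
`Ŝ^z ⊗ T̂^z` on `L²(X × Y, μ × ν) = L²(X, μ) ⊗ L²(Y, ν)`. -/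
def prod [SFinite μ] [SFinite ν] (S : Z2Action μ) (T : Z2Action ν) : Z2Action (μ.prod ν) where
  map z := Prod.map (S.map z) (T.map z)
  measurePreserving z := (S.measurePreserving z).prod (T.measurePreserving z)
  map_zero := by
    filter_upwards [Measure.quasiMeasurePreserving_fst.ae S.map_zero,
      Measure.quasiMeasurePreserving_snd.ae T.map_zero] with p h₁ h₂
    exact Prod.ext h₁ h₂
  map_add z₁ z₂ := by
    filter_upwards [Measure.quasiMeasurePreserving_fst.ae (S.map_add z₁ z₂),
      Measure.quasiMeasurePreserving_snd.ae (T.map_add z₁ z₂)] with p h₁ h₂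
    exact Prod.ext h₁ h₂

/-- Total ergodicity: every transformation `S^z` with `z ≠ 0` is ergodic. -/
def TotallyErgodic (S : Z2Action μ) : Prop :=
  ∀ z : ℤ × ℤ, z ≠ 0 → Ergodic (S.map z) μ

/-- The symmetric square `Ŝ^z ⊙ Ŝ^z`, i.e. the restriction of `Ŝ^z ⊗ Ŝ^z` to the symmetric
functions in `L²(X × X)`, has simple spectrum: the orthogonal complement of the constants
in the space of symmetric functions is a cyclic subspace. -/
def SymmSquareHasSimpleSpectrum [IsProbabilityMeasure μ] (S : Z2Action μ) : Prop :=
  IsCyclicSubspace (S.prod S).koopman (symmSubspace μ ⊓ L2Zero (μ.prod μ))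

/-- `M` is the set of spectral multiplicities of the action on `L²₀(X, μ)`. -/
def HasSpectralMultiplicities [IsProbabilityMeasure μ] (S : Z2Action μ) (M : Set ℕ∞) : Prop :=
  HasMultiplicitySet S.koopman (L2Zero μ) M

end Z2Action

end

/-! Write `S = R × R` and `T' = T × T`. The proof finds the multiplicity two structure of `S` and of
`T'` separately, and then shows that the commutant of `S × T'` sees the two factors independently.

Homogeneous multiplicity two of each square: with `V = R̂^(1,0)`, the operator `V ⊗ 1 - 1 ⊗ V`
commutes with the action and anticommutes with the flip, so it carries symmetric functions to
antisymmetric ones. Its kernel consists of the vectors fixed by `V ⊗ V⁻¹`, which are the constants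
(`Z2Action.ergodic_skew`). Polar decomposition (`IsUnitaryRep.exists_cyclic_map`) turns it into a
unitary equivalence of the symmetric zero mean part, cyclic by hypothesis, with the antisymmetric
part.

Splitting of the commutant: along `w_i` the product action converges weakly to `(1 ⊗ T̂'^e) N`,
where `N` is positive and invertible because `a, b > 0`. An operator in the commutant commutes with
this limit and with its adjoint, hence with the unitary factor of the polar decomposition
(`Commute.of_polar`, `Z2Action.commute_of_weak_limits`). The two sequences give both generators of
`ℤ²`, so the commutant commutes with `1 ⊗ T̂'^z` and `Ŝ^z ⊗ 1` for all `z`.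

Conclusion: let `a_i`, `b_j` be the generators for `S` and `T'`. The space `L²₀` of the product is
`(L²₀ ⊗ 1 ⊕ 1 ⊗ L²₀) ⊕ (L²₀ ⊗ L²₀)`. Splitting makes `a_i ⊗ 1 + 1 ⊗ b_i` generate both of its
summands, giving multiplicity two on the first part. It makes `a_i ⊗ b_j` generate the full tensor
product of the two cyclic subspaces, giving multiplicity four on the second. An intertwiner from the
first part to the second would send `f ⊗ 1` to a vector fixed by `1 ⊗ T̂'^e` and `1 ⊗ g` to one
fixed by `Ŝ^e ⊗ 1`; the second part has no nonzero vector of either kind. -/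

noncomputable section

/-! ### Unitary representations of `ℤ × ℤ` -/

section Abstract

variable {H : Type*} [NormedAddCommGroup H] [InnerProductSpace ℂ H]

/-- `U` is a unitary representation of `ℤ × ℤ` on `H`. -/
structure IsUnitaryRep (U : ℤ × ℤ → H →L[ℂ] H) : Prop where
  zero : U 0 = 1
  add : ∀ z z', U (z + z') = U z * U z'
  inner_map : ∀ z x y, inner ℂ (U z x) (U z y) = inner ℂ x y

variable {U : ℤ × ℤ → H →L[ℂ] H}

theorem mem_cyclicSpan_orbit (z : ℤ × ℤ) (h : H) : U z h ∈ cyclicSpan U h :=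
  Submodule.le_topologicalClosure _ (Submodule.subset_span ⟨z, rfl⟩)

theorem isClosed_cyclicSpan (h : H) : IsClosed (cyclicSpan U h : Set H) :=
  Submodule.isClosed_topologicalClosure _

/-- A closed subspace containing the orbit contains the cyclic subspace. -/
theorem cyclicSpan_le {h : H} {K : Submodule ℂ H} (hK : IsClosed (K : Set H))
    (hh : ∀ z, U z h ∈ K) : cyclicSpan U h ≤ K :=
  Submodule.topologicalClosure_minimal _
    (Submodule.span_le.2 (by rintro _ ⟨z, rfl⟩; exact hh z)) hK

/-- Two cyclic subspaces with orthogonal orbits are orthogonal. -/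
theorem cyclicSpan_isOrtho {h h' : H} (hh : ∀ z z', inner ℂ (U z h) (U z' h') = 0) :
    cyclicSpan U h ⟂ cyclicSpan U h' := by
  rw [Submodule.isOrtho_iff_le]
  refine cyclicSpan_le (Submodule.isClosed_orthogonal _) fun z => ?_
  rw [Submodule.mem_orthogonal']
  intro y hy
  have : cyclicSpan U h' ≤ (Submodule.span ℂ {U z h})ᗮ := by
    refine cyclicSpan_le (Submodule.isClosed_orthogonal _) fun z' => ?_
    rw [Submodule.mem_orthogonal_singleton_iff_inner_right]
    exact hh z z'
  exact Submodule.mem_orthogonal_singleton_iff_inner_right.1 (this hy)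

/-- The preimage of a closed subspace under a continuous linear map is closed. -/
theorem isClosed_comap {E : Type*} [NormedAddCommGroup E] [InnerProductSpace ℂ E]
    {K : Submodule ℂ E} (hK : IsClosed (K : Set E)) (A : H →L[ℂ] E) :
    IsClosed ((K.comap A.toLinearMap : Submodule ℂ H) : Set H) :=
  hK.preimage A.continuous

variable (U) in
/-- The linear map sending finitely supported coefficients to combinations of orbit elements. -/
def orbitMap (h : H) : (ℤ × ℤ →₀ ℂ) →ₗ[ℂ] cyclicSpan U h :=
  Finsupp.linearCombination ℂ fun z => ⟨U z h, mem_cyclicSpan_orbit z h⟩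

theorem coe_orbitMap (h : H) (c : ℤ × ℤ →₀ ℂ) :
    (orbitMap U h c : H) = Finsupp.linearCombination ℂ (fun z => U z h) c := by
  change (cyclicSpan U h).subtype _ = _
  rw [orbitMap, Finsupp.apply_linearCombination]
  rfl

theorem denseRange_orbitMap (h : H) : DenseRange (orbitMap U h) := by
  intro x
  have hx : (x : H) ∈ closure (Submodule.span ℂ (Set.range fun z => U z h) : Set H) := x.2
  rw [Metric.mem_closure_iff] at hx ⊢
  intro ε hε
  obtain ⟨y, hy, hd⟩ := hx ε hε
  rw [SetLike.mem_coe, ← Finsupp.range_linearCombination] at hy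
  obtain ⟨c, rfl⟩ := hy
  rw [← coe_orbitMap] at hd
  exact ⟨_, ⟨c, rfl⟩, hd⟩

namespace IsUnitaryRep

theorem map_neg_apply (hU : IsUnitaryRep U) (z : ℤ × ℤ) (x : H) : U (-z) (U z x) = x := by
  have := hU.add (-z) z
  rw [neg_add_cancel, hU.zero] at this
  exact (DFunLike.congr_fun this x).symm

theorem map_apply_neg (hU : IsUnitaryRep U) (z : ℤ × ℤ) (x : H) : U z (U (-z) x) = x := by
  simpa using hU.map_neg_apply (-z) x

theorem inner_left (hU : IsUnitaryRep U) (z : ℤ × ℤ) (x y : H) :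
    inner ℂ (U z x) y = inner ℂ x (U (-z) y) := by
  rw [← hU.inner_map z x, hU.map_apply_neg]

theorem inner_orbit (hU : IsUnitaryRep U) (z z' : ℤ × ℤ) (x y : H) :
    inner ℂ (U z x) (U z' y) = inner ℂ (U (-z' + z) x) y := by
  rw [hU.add, mul_apply_eq_comp, hU.inner_left (-z'), neg_neg]

theorem commute (hU : IsUnitaryRep U) (z z' : ℤ × ℤ) : Commute (U z) (U z') := by
  rw [Commute, SemiconjBy, ← hU.add, ← hU.add, add_comm]

theorem self_mem_cyclicSpan (hU : IsUnitaryRep U) (h : H) : h ∈ cyclicSpan U h := by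
  simpa [hU.zero] using mem_cyclicSpan_orbit (U := U) 0 h

theorem map_mem_cyclicSpan (hU : IsUnitaryRep U) {h x : H} (z : ℤ × ℤ) (hx : x ∈ cyclicSpan U h) :
    U z x ∈ cyclicSpan U h := by
  have : cyclicSpan U h ≤ (cyclicSpan U h).comap (U z).toLinearMap :=
    cyclicSpan_le (isClosed_comap (isClosed_cyclicSpan h) _) fun z' => by
      have := mem_cyclicSpan_orbit (U := U) (z + z') h
      rw [hU.add] at this
      exact this
  exact this hx

/-- The squared norm of a combination of orbit vectors expands into correlations `⟪U z h, h⟫`, so it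
depends on the generator only through them. -/
theorem norm_orbitMap (hU : IsUnitaryRep U) {h h' : H}
    (hh : ∀ z, inner ℂ (U z h') h' = inner ℂ (U z h) h) (c : ℤ × ℤ →₀ ℂ) :
    ‖(orbitMap U h' c : H)‖ = ‖(orbitMap U h c : H)‖ := by
  rw [← sq_eq_sq₀ (norm_nonneg _) (norm_nonneg _), ← Complex.ofReal_inj]
  push_cast
  simp only [← Complex.coe_algebraMap, ← inner_self_eq_norm_sq_to_K (𝕜 := ℂ), coe_orbitMap,
    Finsupp.linearCombination_apply, Finsupp.sum, sum_inner, inner_sum, inner_smul_left,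
    inner_smul_right, hU.inner_orbit, hh]

/-- The projection onto a closed invariant subspace commutes with the representation. -/
theorem commute_starProjection (hU : IsUnitaryRep U) {K : Submodule ℂ H}
    [K.HasOrthogonalProjection] (hK : ∀ z, ∀ x ∈ K, U z x ∈ K) (z : ℤ × ℤ) :
    Commute K.starProjection (U z) := by
  ext x
  refine (Submodule.eq_starProjection_of_mem_of_inner_eq_zero
    (hK z _ (K.starProjection_apply_mem x)) fun y hy => ?_)
  rw [mul_apply_eq_comp, ContinuousLinearMap.coe_coe, ← map_sub, hU.inner_left]
  exact K.starProjection_inner_eq_zero _ _ (hK _ _ hy)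

variable [CompleteSpace H]

theorem star_eq (hU : IsUnitaryRep U) (z : ℤ × ℤ) : star (U z) = U (-z) := by
  rw [ContinuousLinearMap.star_eq_adjoint]
  refine (ContinuousLinearMap.eq_adjoint_iff _ _).2 (fun x y => ?_) |>.symm
  rw [hU.inner_left, neg_neg]

theorem commute_star (hU : IsUnitaryRep U) {J : H →L[ℂ] H} (hJ : ∀ z, Commute J (U z)) (z) :
    Commute (star J) (U z) := by
  have := (hJ (-z)).star_star
  rwa [hU.star_eq, neg_neg] at this

/-- Cyclic subspaces whose generators have the same correlations are unitarily isomorphic. -/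
theorem restrictionsIsomorphic (hU : IsUnitaryRep U) {h h' : H}
    (hh : ∀ z, inner ℂ (U z h') h' = inner ℂ (U z h) h) :
    RestrictionsIsomorphic U (cyclicSpan U h) (cyclicSpan U h') := by
  have : CompleteSpace (cyclicSpan U h) := (isClosed_cyclicSpan h).completeSpace_coe
  have : CompleteSpace (cyclicSpan U h') := (isClosed_cyclicSpan h').completeSpace_coe
  let Φ := (LinearEquiv.refl ℂ (ℤ × ℤ →₀ ℂ)).extendOfIsometry _ _
    (denseRange_orbitMap (U := U) h) (denseRange_orbitMap (U := U) h')
    (fun c => hU.norm_orbitMap hh c)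
  have hΦ : ∀ c, Φ (orbitMap U h c) = orbitMap U h' c := fun c =>
    (LinearEquiv.refl ℂ (ℤ × ℤ →₀ ℂ)).extendOfIsometry_eq _ _ _ _ _ c
  refine ⟨Φ, fun z x y hxy => ?_⟩
  have hy : y = ⟨U z x, hU.map_mem_cyclicSpan z x.2⟩ := Subtype.ext hxy
  subst hy
  have hcl : IsClosed {x : cyclicSpan U h |
      (Φ ⟨U z x, hU.map_mem_cyclicSpan z x.2⟩ : H) = U z (Φ x : H)} := by
    refine isClosed_eq ?_ ?_
    · exact continuous_subtype_val.comp (Φ.continuous.comp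
        (Continuous.subtype_mk ((U z).continuous.comp continuous_subtype_val) _))
    · exact (U z).continuous.comp (continuous_subtype_val.comp Φ.continuous)
  refine (denseRange_orbitMap (U := U) h).induction_on x hcl fun c => ?_
  -- `U z` translates coefficients in the same way for every generator, so `Φ` intertwines on the
  -- dense set of finite combinations.
  have shift : ∀ k : H, U z (orbitMap U k c) = orbitMap U k (c.mapDomain (z + ·)) := by
    intro k
    rw [coe_orbitMap, coe_orbitMap, Finsupp.linearCombination_mapDomain]
    refine (Finsupp.apply_linearCombination ℂ (U z).toLinearMap _ _).trans ?_
    congr 2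
    funext z'
    simp [hU.add]
  have h1 : (⟨U z (orbitMap U h c), hU.map_mem_cyclicSpan z (orbitMap U h c).2⟩ :
      cyclicSpan U h) = orbitMap U h (c.mapDomain (z + ·)) := Subtype.ext (shift h)
  change (Φ _ : H) = U z (Φ _)
  rw [h1, hΦ, hΦ, shift]

/-- Polar decomposition: an operator which commutes with the representation and is injective on
a cyclic subspace carries it to a cyclic subspace with the same correlations. -/
theorem exists_cyclic_map (hU : IsUnitaryRep U) {h : H} {D : H →L[ℂ] H}
    (hD : ∀ z, Commute D (U z)) (hinj : ∀ x ∈ cyclicSpan U h, D x = 0 → x = 0) :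
    ∃ h', cyclicSpan U h' = ((cyclicSpan U h).map D.toLinearMap).topologicalClosure ∧
      ∀ z, inner ℂ (U z h') h' = inner ℂ (U z h) h := by
  set K := cyclicSpan U h with hK
  have : CompleteSpace K := (isClosed_cyclicSpan h).completeSpace_coe
  set L := (K.map D.toLinearMap).topologicalClosure with hL
  have : CompleteSpace L := (Submodule.isClosed_topologicalClosure _).completeSpace_coe
  set p := K.starProjection with hp
  have hpU : ∀ z, Commute p (U z) :=
    hU.commute_starProjection fun z x hx => hU.map_mem_cyclicSpan z hx
  set A := D * p with hA
  set P := CFC.abs A with hP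
  have hAU : ∀ z, Commute A (U z) := fun z => (hD z).mul_left (hpU z)
  have hPU : ∀ z, Commute P (U z) := fun z =>
    (hAU z).cfcAbs_left (by rw [hU.star_eq]; exact hAU _)
  have hPsa : star P = P := (CFC.abs_nonneg A).isSelfAdjoint
  have hPin : ∀ x y, inner ℂ (P x) (P y) = inner ℂ (A x) (A y) := by
    intro x y
    have h1 : star P * P = star A * A := by rw [hPsa, CFC.abs_mul_abs]
    have h2 := congrArg (fun B : H →L[ℂ] H => inner ℂ x (B y)) h1
    simpa only [mul_apply_eq_comp, ContinuousLinearMap.star_eq_adjoint,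
      ContinuousLinearMap.adjoint_inner_right] using h2
  have hnorm : ∀ x, ‖A x‖ = ‖P x‖ := by
    intro x
    rw [← sq_eq_sq₀ (norm_nonneg _) (norm_nonneg _), ← Complex.ofReal_inj]
    push_cast
    have := hPin x x
    rw [inner_self_eq_norm_sq_to_K, inner_self_eq_norm_sq_to_K] at this
    simpa using this.symm
  -- Here injectivity of `D` on `K` enters: the kernel of `P = |D p|` is no larger than `Kᗮ`. Hence
  -- the self-adjoint `P` has dense range in `K`.
  have hker : ∀ x, P x = 0 → x ∈ Kᗮ := by
    intro x hx
    have h1 : D (p x) = 0 := by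
      have := hnorm x
      rw [hx, norm_zero, norm_eq_zero] at this
      exact this
    exact (Submodule.starProjection_apply_eq_zero_iff K).1
      (hinj _ (K.starProjection_apply_mem x) h1)
  have hPmem : ∀ x, P x ∈ K := by
    intro x
    rw [← K.orthogonal_orthogonal, Submodule.mem_orthogonal']
    intro y hy
    rw [← hPsa, ContinuousLinearMap.star_eq_adjoint, ContinuousLinearMap.adjoint_inner_left]
    have : P y = 0 := by
      rw [← norm_eq_zero, ← hnorm, hA, mul_apply_eq_comp,
        (Submodule.starProjection_apply_eq_zero_iff K).2 hy, map_zero, norm_zero]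
    rw [this, inner_zero_right]
  have hAmem : ∀ x, A x ∈ L := fun x =>
    Submodule.le_topologicalClosure _ ⟨p x, K.starProjection_apply_mem x, rfl⟩
  let e₁ : H →ₗ[ℂ] K := P.toLinearMap.codRestrict K hPmem
  let e₂ : H →ₗ[ℂ] L := A.toLinearMap.codRestrict L hAmem
  have hd₁ : DenseRange e₁ := by
    change Dense (e₁.range : Set K)
    rw [Submodule.dense_iff_topologicalClosure_eq_top, Submodule.topologicalClosure_eq_top_iff,
      Submodule.eq_bot_iff]
    intro k hk
    rw [Submodule.mem_orthogonal'] at hk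
    have h1 : P k = 0 := by
      rw [← inner_self_eq_zero (𝕜 := ℂ)]
      have := hk (e₁ (P k)) ⟨_, rfl⟩
      rw [Submodule.coe_inner] at this
      change inner ℂ (k : H) (P (P k)) = 0 at this
      rwa [← ContinuousLinearMap.adjoint_inner_left, ← ContinuousLinearMap.star_eq_adjoint,
        hPsa] at this
    have h2 := hker _ h1
    rw [Submodule.mem_orthogonal] at h2
    exact Subtype.ext (inner_self_eq_zero.1 (h2 k k.2))
  have hd₂ : DenseRange e₂ := by
    intro x
    have hx : (x : H) ∈ closure (K.map D.toLinearMap : Set H) := x.2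
    rw [Metric.mem_closure_iff] at hx ⊢
    intro ε hε
    obtain ⟨_, ⟨k, hk, rfl⟩, hd⟩ := hx ε hε
    refine ⟨_, ⟨k, rfl⟩, ?_⟩
    have : A k = D k := by
      rw [hA, mul_apply_eq_comp, Submodule.starProjection_eq_self_iff.2 hk]
    rw [Subtype.dist_eq]
    change dist (x : H) (A k) < ε
    rwa [this]
  -- The polar isometry `P x ↦ A x`, extended to a unitary from `K` onto `L`; the new generator is
  -- the image of `h`.
  let V := (LinearEquiv.refl ℂ H).extendOfIsometry e₁ e₂ hd₁ hd₂ hnorm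
  have hV : ∀ x, V (e₁ x) = e₂ x := fun x =>
    (LinearEquiv.refl ℂ H).extendOfIsometry_eq _ _ _ _ _ x
  have hVU : ∀ z (x : K), (V ⟨U z x, hU.map_mem_cyclicSpan z x.2⟩ : H) = U z (V x : H) := by
    intro z x
    refine hd₁.induction_on x (isClosed_eq ?_ ?_) fun x => ?_
    rotate_left 2
    · have h1 : (⟨U z (e₁ x), hU.map_mem_cyclicSpan z (e₁ x).2⟩ : K) = e₁ (U z x) :=
        Subtype.ext (DFunLike.congr_fun (hPU z).eq x).symm
      rw [h1, hV, hV]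
      exact DFunLike.congr_fun (hAU z).eq x
    · exact continuous_subtype_val.comp (V.continuous.comp
        (Continuous.subtype_mk ((U z).continuous.comp continuous_subtype_val) _))
    · exact (U z).continuous.comp (continuous_subtype_val.comp V.continuous)
  let h₀ : K := ⟨h, hU.self_mem_cyclicSpan h⟩
  refine ⟨V h₀, le_antisymm ?_ ?_, fun z => ?_⟩
  · exact cyclicSpan_le (Submodule.isClosed_topologicalClosure _) fun z => by
      rw [← hVU]; exact (V _).2
  · refine Submodule.topologicalClosure_minimal _ ?_ (isClosed_cyclicSpan _)
    rintro _ ⟨k, hk, rfl⟩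
    let W : K →L[ℂ] H := L.subtypeL ∘L (V.toContinuousLinearEquiv : K →L[ℂ] L)
    have key : ∀ x : K, (V x : H) ∈ cyclicSpan U (V h₀ : H) := by
      intro x
      refine (denseRange_orbitMap (U := U) h).induction_on x
        ((isClosed_cyclicSpan _).preimage (continuous_subtype_val.comp V.continuous)) fun c => ?_
      change W _ ∈ _
      rw [orbitMap, Finsupp.linearCombination_apply, Finsupp.sum, map_sum]
      refine Submodule.sum_mem _ fun z _ => ?_
      rw [map_smul]
      refine Submodule.smul_mem _ _ ?_
      change (V ⟨U z h₀, _⟩ : H) ∈ _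
      rw [hVU]
      exact mem_cyclicSpan_orbit z _
    have h2 : D k = V (e₁ k) := by
      rw [hV]
      change D k = D (p k)
      rw [Submodule.starProjection_eq_self_iff.2 hk]
    change D k ∈ _
    rw [h2]
    exact key _
  · rw [← hVU, ← Submodule.coe_inner, V.inner_map_map]
    rfl

end IsUnitaryRep

/-- An operator commuting with a sequence of operators commutes with its weak limit. -/
theorem WeakOperatorTendsto.commute [CompleteSpace H] {A : ℕ → H →L[ℂ] H} {B J : H →L[ℂ] H}
    (hA : WeakOperatorTendsto A B) (hJ : ∀ i, Commute J (A i)) : Commute J B := by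
  ext x
  refine ext_inner_right ℂ fun y => ?_
  simp only [mul_apply_eq_comp]
  -- Weak convergence is tested at `(x, J* y)` and at `(J x, y)`; commutation makes the two
  -- sequences equal.
  have h1 := hA x (ContinuousLinearMap.adjoint J y)
  have h2 := hA (J x) y
  simp only [ContinuousLinearMap.adjoint_inner_right] at h1
  refine tendsto_nhds_unique h1 (h2.congr fun i => ?_)
  rw [← mul_apply_eq_comp (A i), ← (hJ i).eq, mul_apply_eq_comp]

/-- If `N = M²` with `M` self-adjoint is invertible and `V` is an isometry, then
an operator commuting with `V N` and its adjoint commutes with `V`. -/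
theorem Commute.of_polar [CompleteSpace H] {J N N' M V : H →L[ℂ] H}
    (hM : star M = M) (hN : N = M * M) (hNN : N * N' = 1) (hV : star V * V = 1)
    (h₁ : Commute J (V * N)) (h₂ : Commute J (star (V * N))) :
    Commute J V := by
  have hNsa : star N = N := by rw [hN, star_mul, hM]
  have hN0 : 0 ≤ N := by
    have := star_mul_self_nonneg M
    rwa [hM, ← hN] at this
  -- The isometry cancels, so `J` commutes with `N²`, hence with its positive square root `N` by
  -- functional calculus. Invertibility of `N` then leaves `V`.
  have hsq : star (V * N) * (V * N) = N * N := by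
    rw [star_mul, hNsa, mul_assoc, ← mul_assoc (star V), hV, one_mul]
  have h3 : Commute J (N * N) := hsq ▸ h₂.mul_right h₁
  have h4 : Commute J N := by
    have : CFC.abs N = N := CFC.abs_of_nonneg N
    rw [← this, CFC.abs, hNsa]
    exact (h3.symm.cfcₙ_nnreal _).symm
  have h5 : J * V * N = V * J * N := by
    rw [mul_assoc, h₁.eq, mul_assoc, mul_assoc, h4.eq]
  have h6 := congrArg (· * N') h5
  simp only [mul_assoc, hNN, mul_one] at h6
  exact h6

end Abstract

/-! ### Tensor products of operators -/

section TensorNorm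

open TensorProduct

variable {E F : Type*} [NormedAddCommGroup E] [InnerProductSpace ℂ E]
  [NormedAddCommGroup F] [InnerProductSpace ℂ F]

theorem norm_sq_sum_tmul {ι : Type*} [Fintype ι] (f : ι → E) {b : ι → F} (hb : Orthonormal ℂ b) :
    ‖∑ i, f i ⊗ₜ[ℂ] b i‖ ^ 2 = ∑ i, ‖f i‖ ^ 2 := by
  classical
  rw [← Complex.ofReal_inj]
  push_cast
  simp only [← Complex.coe_algebraMap, ← inner_self_eq_norm_sq_to_K (𝕜 := ℂ), sum_inner, inner_sum,
    TensorProduct.inner_tmul, orthonormal_iff_ite.1 hb]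
  simp

/-- A tensor involves only a finite-dimensional `F'`. Expanded over an orthonormal basis of `F'`, it
is moved by `A` coefficientwise, and Pythagoras reduces the bound to each coefficient. -/
theorem norm_map_id_le (A : E →L[ℂ] E) (x : E ⊗[ℂ] F) :
    ‖TensorProduct.map A.toLinearMap LinearMap.id x‖ ≤ ‖A‖ * ‖x‖ := by
  obtain ⟨E', F', _, _, hz⟩ := exists_finite_submodule_of_setFinite {x} (Set.finite_singleton x)
  obtain ⟨y, rfl⟩ := Set.singleton_subset_iff.mp hz
  let b := stdOrthonormalBasis ℂ F'
  have hb : Orthonormal ℂ (fun i => (b i : F)) := b.orthonormal.comp_linearIsometry F'.subtypeₗᵢ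
  obtain ⟨f, hf⟩ : ∃ f : Fin (Module.finrank ℂ F') → E',
      y = ∑ i, f i ⊗ₜ[ℂ] b i := by
    refine ⟨fun i => TensorProduct.equivFinsuppOfBasisRight b.toBasis y i, ?_⟩
    conv_lhs => rw [← (TensorProduct.equivFinsuppOfBasisRight b.toBasis).symm_apply_apply y]
    rw [TensorProduct.equivFinsuppOfBasisRight_symm_apply, Finsupp.sum_fintype _ _ (by simp)]
    simp
  subst hf
  rw [← sq_le_sq₀ (norm_nonneg _) (by positivity), mul_pow]
  simp only [map_sum, TensorProduct.mapIncl, TensorProduct.map_tmul, Submodule.subtype_apply,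
    LinearMap.id_apply, ContinuousLinearMap.coe_coe]
  rw [norm_sq_sum_tmul _ hb, norm_sq_sum_tmul _ hb, Finset.mul_sum]
  gcongr with i
  rw [← mul_pow]
  gcongr
  exact A.le_opNorm _

/-- `A ⊗ B = (A ⊗ 1)(1 ⊗ B)`, and the second factor is conjugate to `B ⊗ 1` by the isometric flip.
-/
theorem norm_map_le (A : E →L[ℂ] E) (B : F →L[ℂ] F) (x : E ⊗[ℂ] F) :
    ‖TensorProduct.map A.toLinearMap B.toLinearMap x‖ ≤ ‖A‖ * ‖B‖ * ‖x‖ := by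
  have h1 : TensorProduct.map A.toLinearMap B.toLinearMap x =
      TensorProduct.map A.toLinearMap LinearMap.id
        (TensorProduct.comm ℂ F E (TensorProduct.map B.toLinearMap LinearMap.id
          (TensorProduct.comm ℂ E F x))) := by
    induction x with
    | zero => simp
    | tmul f g => simp
    | add x y hx hy => simp [hx, hy]
  rw [h1, mul_assoc]
  refine (norm_map_id_le A _).trans ?_
  gcongr
  rw [TensorProduct.norm_comm]
  refine (norm_map_id_le B _).trans ?_
  rw [TensorProduct.norm_comm]

end TensorNorm

/-! ### `L²` of a product as the completed tensor product, and the operators `A ⊗ B` on it -/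

section LpTensor

variable {X Y : Type*} [MeasurableSpace X] [MeasurableSpace Y] {μ : Measure X} {ν : Measure Y}

theorem memLp_tmul [SFinite μ] [SFinite ν] (f : Lp ℂ 2 μ) (g : Lp ℂ 2 ν) :
    MemLp (fun p : X × Y => f p.1 * g p.2) 2 (μ.prod ν) := by
  have hm : AEStronglyMeasurable (fun p : X × Y => f p.1 * g p.2) (μ.prod ν) :=
    (Lp.aestronglyMeasurable f).comp_fst.mul (Lp.aestronglyMeasurable g).comp_snd
  rw [memLp_two_iff_integrable_sq_norm hm]
  have hf := (memLp_two_iff_integrable_sq_norm (Lp.aestronglyMeasurable f)).1 (Lp.memLp f)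
  have hg := (memLp_two_iff_integrable_sq_norm (Lp.aestronglyMeasurable g)).1 (Lp.memLp g)
  simpa only [norm_mul, mul_pow] using hf.mul_prod hg

variable [IsProbabilityMeasure μ] [IsProbabilityMeasure ν]

/-- The function `f(x) g(y)`, bilinearly in `f` and `g`. -/
def lpTmul : Lp ℂ 2 μ →ₗ[ℂ] Lp ℂ 2 ν →ₗ[ℂ] Lp ℂ 2 (μ.prod ν) :=
  LinearMap.mk₂ ℂ (fun f g => (memLp_tmul f g).toLp _)
    (fun f f' g => by
      rw [← MemLp.toLp_add]
      refine MemLp.toLp_congr _ _ ?_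
      filter_upwards [Measure.quasiMeasurePreserving_fst.ae (Lp.coeFn_add f f')] with p hp
      simp only [hp, Pi.add_apply, add_mul])
    (fun c f g => by
      rw [← MemLp.toLp_const_smul]
      refine MemLp.toLp_congr _ _ ?_
      filter_upwards [Measure.quasiMeasurePreserving_fst.ae (Lp.coeFn_smul c f)] with p hp
      simp only [hp, Pi.smul_apply, smul_eq_mul, mul_assoc])
    (fun f g g' => by
      rw [← MemLp.toLp_add]
      refine MemLp.toLp_congr _ _ ?_
      filter_upwards [Measure.quasiMeasurePreserving_snd.ae (Lp.coeFn_add g g')] with p hp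
      simp only [hp, Pi.add_apply, mul_add])
    (fun c f g => by
      rw [← MemLp.toLp_const_smul]
      refine MemLp.toLp_congr _ _ ?_
      filter_upwards [Measure.quasiMeasurePreserving_snd.ae (Lp.coeFn_smul c g)] with p hp
      simp only [hp, Pi.smul_apply, smul_eq_mul, mul_left_comm])

theorem coeFn_lpTmul (f : Lp ℂ 2 μ) (g : Lp ℂ 2 ν) :
    lpTmul f g =ᵐ[μ.prod ν] fun p => f p.1 * g p.2 :=
  MemLp.coeFn_toLp (memLp_tmul f g)

theorem inner_lpTmul (f f' : Lp ℂ 2 μ) (g g' : Lp ℂ 2 ν) :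
    inner ℂ (lpTmul f g) (lpTmul f' g') = inner ℂ f f' * inner ℂ g g' := by
  rw [L2.inner_def, L2.inner_def, L2.inner_def, ← integral_prod_mul]
  refine integral_congr_ae ?_
  filter_upwards [coeFn_lpTmul f g, coeFn_lpTmul f' g'] with p h1 h2
  simp only [h1, h2, RCLike.inner_apply, map_mul]
  ring

theorem norm_lpTmul (f : Lp ℂ 2 μ) (g : Lp ℂ 2 ν) : ‖lpTmul f g‖ = ‖f‖ * ‖g‖ := by
  rw [← sq_eq_sq₀ (norm_nonneg _) (by positivity), ← Complex.ofReal_inj, mul_pow]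
  push_cast
  simp only [← Complex.coe_algebraMap, ← inner_self_eq_norm_sq_to_K (𝕜 := ℂ), inner_lpTmul]

/-- `lpTmul` as a continuous bilinear map. -/
def lpTmulL : Lp ℂ 2 μ →L[ℂ] Lp ℂ 2 ν →L[ℂ] Lp ℂ 2 (μ.prod ν) :=
  lpTmul.mkContinuous₂ 1 fun f g => by rw [norm_lpTmul, one_mul]

/-- A function orthogonal to all products `f(x) g(y)` vanishes. -/
theorem eq_zero_of_inner_lpTmul {F : Lp ℂ 2 (μ.prod ν)}
    (h : ∀ (f : Lp ℂ 2 μ) (g : Lp ℂ 2 ν), inner ℂ (lpTmul f g) F = 0) : F = 0 := by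
  have hF_int : Integrable F (μ.prod ν) := (Lp.memLp F).integrable (by norm_num)
  -- Testing against indicators gives vanishing integrals over rectangles. These form a π-system
  -- generating the product σ-algebra, which yields all measurable sets.
  have hrect : ∀ (s : Set X) (t : Set Y), MeasurableSet s → MeasurableSet t →
      ∫ p in s ×ˢ t, F p ∂μ.prod ν = 0 := by
    intro s t hs ht
    have h1 : lpTmul (indicatorConstLp 2 hs (measure_ne_top μ s) (1 : ℂ))
        (indicatorConstLp 2 ht (measure_ne_top ν t) (1 : ℂ)) =
        indicatorConstLp 2 (hs.prod ht) (measure_ne_top (μ.prod ν) _) (1 : ℂ) := by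
      refine Lp.ext ?_
      filter_upwards [coeFn_lpTmul (indicatorConstLp 2 hs (measure_ne_top μ s) (1 : ℂ))
        (indicatorConstLp 2 ht (measure_ne_top ν t) (1 : ℂ)),
        Measure.quasiMeasurePreserving_fst.ae
          (indicatorConstLp_coeFn (p := 2) (hs := hs) (hμs := measure_ne_top μ s) (c := (1 : ℂ))),
        Measure.quasiMeasurePreserving_snd.ae
          (indicatorConstLp_coeFn (p := 2) (hs := ht) (hμs := measure_ne_top ν t) (c := (1 : ℂ))),
        indicatorConstLp_coeFn (p := 2) (hs := hs.prod ht)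
          (hμs := measure_ne_top (μ.prod ν) _) (c := (1 : ℂ))] with p h1 h2 h3 h4
      rw [h1, h2, h3, h4]
      by_cases hp : p.1 ∈ s <;> by_cases hq : p.2 ∈ t <;> simp [Set.indicator, hp, hq]
    rw [← L2.inner_indicatorConstLp_one (𝕜 := ℂ) (hs.prod ht) (measure_ne_top (μ.prod ν) _) F,
      ← h1]
    exact h _ _
  have hset : ∀ E, MeasurableSet E → ∫ p in E, F p ∂μ.prod ν = 0 := by
    intro E hE
    induction E, hE using MeasurableSpace.induction_on_inter generateFrom_prod.symm
      isPiSystem_prod with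
    | empty => simp
    | basic t ht =>
      obtain ⟨s, hs, t, ht, rfl⟩ := ht
      exact hrect s t hs ht
    | compl t ht ih =>
      have h1 := integral_add_compl ht hF_int
      rw [ih, zero_add] at h1
      rw [h1, ← setIntegral_univ, ← Set.univ_prod_univ]
      exact hrect _ _ .univ .univ
    | iUnion f hd hm ih =>
      rw [integral_iUnion hm hd hF_int.integrableOn]
      simp [ih]
  refine Lp.ext ?_
  refine (hF_int.ae_eq_zero_of_forall_setIntegral_eq_zero fun s hs _ => hset s hs).trans ?_
  exact (Lp.coeFn_zero _ _ _).symm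

theorem span_lpTmul_dense :
    (Submodule.span ℂ {F | ∃ (f : Lp ℂ 2 μ) (g : Lp ℂ 2 ν), lpTmul f g = F}).topologicalClosure
      = ⊤ := by
  rw [Submodule.topologicalClosure_eq_top_iff, Submodule.eq_bot_iff]
  intro F hF
  refine eq_zero_of_inner_lpTmul fun f g => ?_
  exact (Submodule.mem_orthogonal _ _).1 hF _ (Submodule.subset_span ⟨f, g, rfl⟩)

/-- Operators agreeing on products `f(x) g(y)` are equal. -/
theorem ext_lpTmul {E : Type*} [NormedAddCommGroup E] [NormedSpace ℂ E]
    {A B : Lp ℂ 2 (μ.prod ν) →L[ℂ] E} (h : ∀ f g, A (lpTmul f g) = B (lpTmul f g)) : A = B := by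
  refine ContinuousLinearMap.ext_on (s := {F | ∃ (f : Lp ℂ 2 μ) (g : Lp ℂ 2 ν), lpTmul f g = F})
    ?_ ?_
  · rw [Submodule.dense_iff_topologicalClosure_eq_top]
    exact span_lpTmul_dense
  · rintro _ ⟨f, g, rfl⟩
    exact h f g

variable (μ ν) in
/-- The isometric embedding of the algebraic tensor product into `L²` of the product. -/
def lpTensor : TensorProduct ℂ (Lp ℂ 2 μ) (Lp ℂ 2 ν) →ₗᵢ[ℂ] Lp ℂ 2 (μ.prod ν) :=
  (TensorProduct.lift lpTmul).isometryOfInner fun x y => by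
    induction x with
    | zero => simp
    | add x x' hx hx' => simp [inner_add_left, hx, hx']
    | tmul f g =>
      induction y with
      | zero => simp
      | add y y' hy hy' => simp only [map_add, inner_add_right, hy, hy']
      | tmul f' g' => simp [inner_lpTmul]

theorem lpTensor_tmul (f : Lp ℂ 2 μ) (g : Lp ℂ 2 ν) :
    lpTensor μ ν (f ⊗ₜ[ℂ] g) = lpTmul f g := by
  simp [lpTensor]

theorem denseRange_lpTensor : DenseRange (lpTensor μ ν) := by
  change Dense ((lpTensor μ ν).toLinearMap.range : Set (Lp ℂ 2 (μ.prod ν)))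
  rw [Submodule.dense_iff_topologicalClosure_eq_top, eq_top_iff, ← span_lpTmul_dense]
  refine Submodule.topologicalClosure_mono (Submodule.span_le.2 ?_)
  rintro _ ⟨f, g, rfl⟩
  exact ⟨_, lpTensor_tmul f g⟩

/-- The operator `A ⊗ B` on `L²(μ × ν)`. -/
def opTensor (A : Lp ℂ 2 μ →L[ℂ] Lp ℂ 2 μ) (B : Lp ℂ 2 ν →L[ℂ] Lp ℂ 2 ν) :
    Lp ℂ 2 (μ.prod ν) →L[ℂ] Lp ℂ 2 (μ.prod ν) :=
  ((lpTensor μ ν).toLinearMap ∘ₗ TensorProduct.map A.toLinearMap B.toLinearMap).extendOfNorm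
    (lpTensor μ ν).toLinearMap

theorem norm_lpTensor_map_le (A : Lp ℂ 2 μ →L[ℂ] Lp ℂ 2 μ) (B : Lp ℂ 2 ν →L[ℂ] Lp ℂ 2 ν) (x) :
    ‖((lpTensor μ ν).toLinearMap ∘ₗ TensorProduct.map A.toLinearMap B.toLinearMap) x‖ ≤
      ‖A‖ * ‖B‖ * ‖(lpTensor μ ν).toLinearMap x‖ := by
  have := norm_map_le A B x
  simpa using this

theorem opTensor_lpTmul (A : Lp ℂ 2 μ →L[ℂ] Lp ℂ 2 μ) (B : Lp ℂ 2 ν →L[ℂ] Lp ℂ 2 ν) (f g) :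
    opTensor A B (lpTmul f g) = lpTmul (A f) (B g) := by
  have := LinearMap.extendOfNorm_eq (f := (lpTensor μ ν).toLinearMap ∘ₗ
    TensorProduct.map A.toLinearMap B.toLinearMap) (e := (lpTensor μ ν).toLinearMap)
    denseRange_lpTensor ⟨_, norm_lpTensor_map_le A B⟩ (f ⊗ₜ[ℂ] g)
  simpa [lpTensor_tmul, opTensor] using this

theorem norm_opTensor_le (A : Lp ℂ 2 μ →L[ℂ] Lp ℂ 2 μ) (B : Lp ℂ 2 ν →L[ℂ] Lp ℂ 2 ν) :
    ‖opTensor A B‖ ≤ ‖A‖ * ‖B‖ :=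
  LinearMap.opNorm_extendOfNorm_le denseRange_lpTensor (by positivity) (norm_lpTensor_map_le A B)

theorem opTensor_mul (A A' : Lp ℂ 2 μ →L[ℂ] Lp ℂ 2 μ) (B B' : Lp ℂ 2 ν →L[ℂ] Lp ℂ 2 ν) :
    opTensor A B * opTensor A' B' = opTensor (A * A') (B * B') :=
  ext_lpTmul fun f g => by simp only [mul_apply_eq_comp, opTensor_lpTmul]

theorem opTensor_one :
    opTensor (1 : Lp ℂ 2 μ →L[ℂ] Lp ℂ 2 μ) (1 : Lp ℂ 2 ν →L[ℂ] Lp ℂ 2 ν) = 1 :=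
  ext_lpTmul fun f g => by rw [opTensor_lpTmul]; rfl

theorem star_opTensor (A : Lp ℂ 2 μ →L[ℂ] Lp ℂ 2 μ) (B : Lp ℂ 2 ν →L[ℂ] Lp ℂ 2 ν) :
    star (opTensor A B) = opTensor (star A) (star B) := by
  refine ext_lpTmul fun f g => ?_
  rw [← sub_eq_zero]
  refine eq_zero_of_inner_lpTmul fun f' g' => ?_
  simp only [ContinuousLinearMap.star_eq_adjoint]
  rw [inner_sub_right, ContinuousLinearMap.adjoint_inner_right, opTensor_lpTmul, opTensor_lpTmul,
    inner_lpTmul, inner_lpTmul, ContinuousLinearMap.adjoint_inner_right,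
    ContinuousLinearMap.adjoint_inner_right, sub_self]

end LpTensor

/-! ### Weak limits of tensor products -/

section Weak

/-- The set of points of convergence of a uniformly Lipschitz sequence of functions is closed. -/
theorem isClosed_setOf_tendsto {H : Type*} [NormedAddCommGroup H] {φ : ℕ → H → ℂ} {ψ : H → ℂ} {C : ℝ}
    (hφ : ∀ i x y, ‖φ i x - φ i y‖ ≤ C * ‖x - y‖) (hψ : ∀ x y, ‖ψ x - ψ y‖ ≤ C * ‖x - y‖) :
    IsClosed {x | Tendsto (fun i => φ i x) atTop (𝓝 (ψ x))} := by
  -- The sign of `C` is not known; `|C| + 1` is a positive Lipschitz constant by which one may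
  -- divide.
  have hC : 0 < |C| + 1 := by positivity
  have hle : ∀ x y : H, C * ‖x - y‖ ≤ (|C| + 1) * ‖x - y‖ := fun x y => by
    gcongr; linarith [le_abs_self C]
  rw [← closure_subset_iff_isClosed]
  intro x hx
  rw [Set.mem_ofPred_eq, Metric.tendsto_atTop]
  intro ε hε
  obtain ⟨y, hy, hxy⟩ := Metric.mem_closure_iff.1 hx (ε / (3 * (|C| + 1))) (by positivity)
  obtain ⟨N, hN⟩ := Metric.tendsto_atTop.1 hy (ε / 3) (by positivity)
  refine ⟨N, fun n hn => ?_⟩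
  have h0 : (|C| + 1) * ‖x - y‖ < ε / 3 := by
    rw [dist_eq_norm, lt_div_iff₀ (by positivity)] at hxy
    linarith
  have h1 := (hφ n x y).trans (hle x y)
  have h2 := (hψ x y).trans (hle x y)
  have h3 := hN n hn
  rw [dist_eq_norm] at h3 ⊢
  have : φ n x - ψ x = (φ n x - φ n y) + (φ n y - ψ y) - (ψ x - ψ y) := by ring
  rw [this]
  refine (norm_sub_le _ _).trans_lt ?_
  linarith [norm_add_le (φ n x - φ n y) (φ n y - ψ y)]

variable {H : Type*} [NormedAddCommGroup H] [InnerProductSpace ℂ H]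

/-- For a bounded sequence, weak convergence may be checked on a total set. -/
theorem weakOperatorTendsto_of_total {A : ℕ → H →L[ℂ] H} {B : H →L[ℂ] H} {C : ℝ}
    (hA : ∀ i, ‖A i‖ ≤ C) {S : Set H} (hS : (Submodule.span ℂ S).topologicalClosure = ⊤)
    (h : ∀ f ∈ S, ∀ g ∈ S, Tendsto (fun i => inner ℂ (A i f) g) atTop (𝓝 (inner ℂ (B f) g))) :
    WeakOperatorTendsto A B := by
  have hC : 0 ≤ C := (norm_nonneg _).trans (hA 0)
  have bound : ∀ (T : H →L[ℂ] H) (D : ℝ), 0 ≤ D → ‖T‖ ≤ D → ∀ x y, ‖inner ℂ (T x) y‖ ≤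
      D * ‖x‖ * ‖y‖ := fun T D hD hT x y =>
    (norm_inner_le_norm _ _).trans (by gcongr; exact T.le_of_opNorm_le hT x)
  -- One constant bounding the sequence and its limit, as `isClosed_setOf_tendsto` requires. Density
  -- is then used in `g` for `f ∈ S`, and afterwards in `f`.
  set D := max C ‖B‖ with hDdef
  have hD : 0 ≤ D := hC.trans (le_max_left _ _)
  have hAD : ∀ i, ‖A i‖ ≤ D := fun i => (hA i).trans (le_max_left _ _)
  have hBD : ‖B‖ ≤ D := le_max_right _ _
  have step : ∀ f ∈ S, ∀ g, Tendsto (fun i => inner ℂ (A i f) g) atTop (𝓝 (inner ℂ (B f) g)) := by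
    intro f hf g
    have hcl := isClosed_setOf_tendsto (φ := fun i g => inner ℂ (A i f) g)
      (ψ := fun g => inner ℂ (B f) g) (C := D * ‖f‖)
      (fun i x y => by rw [← inner_sub_right]; exact bound _ _ hD (hAD i) _ _)
      (fun x y => by rw [← inner_sub_right]; exact bound _ _ hD hBD _ _)
    have hg : g ∈ closure (Submodule.span ℂ S : Set H) := by
      rw [← Submodule.topologicalClosure_coe, hS]; trivial
    refine closure_minimal (fun x hx => ?_) hcl hg
    induction hx using Submodule.span_induction with
    | mem x hx => exact h f hf x hx
    | zero => simp
    | add x y _ _ hx hy => simpa [inner_add_right] using hx.add hy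
    | smul c x _ hx => simpa [inner_smul_right] using hx.const_mul c
  intro f g
  have hcl := isClosed_setOf_tendsto (φ := fun i f => inner ℂ (A i f) g)
    (ψ := fun f => inner ℂ (B f) g) (C := D * ‖g‖)
    (fun i x y => by
      rw [← inner_sub_left, ← map_sub, mul_right_comm]; exact bound _ _ hD (hAD i) _ _)
    (fun x y => by
      rw [← inner_sub_left, ← map_sub, mul_right_comm]; exact bound _ _ hD hBD _ _)
  have hf : f ∈ closure (Submodule.span ℂ S : Set H) := by
    rw [← Submodule.topologicalClosure_coe, hS]; trivial
  refine closure_minimal (fun x hx => ?_) hcl hf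
  induction hx using Submodule.span_induction with
  | mem x hx => exact step x hx g
  | zero => simp
  | add x y _ _ hx hy => simpa [inner_add_left] using hx.add hy
  | smul c x _ hx =>
    simpa [inner_smul_left, mul_comm] using hx.const_mul (starRingEnd ℂ c)

variable {X Y : Type*} [MeasurableSpace X] [MeasurableSpace Y] {μ : Measure X} {ν : Measure Y}
  [IsProbabilityMeasure μ] [IsProbabilityMeasure ν]

/-- Between product functions the matrix coefficients factor, so their limits multiply. The norm
bounds allow testing on this total set. -/
theorem WeakOperatorTendsto.opTensor {A : ℕ → Lp ℂ 2 μ →L[ℂ] Lp ℂ 2 μ} {A'}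
    {B : ℕ → Lp ℂ 2 ν →L[ℂ] Lp ℂ 2 ν} {B'} (hA : WeakOperatorTendsto A A')
    (hB : WeakOperatorTendsto B B') (hA1 : ∀ i, ‖A i‖ ≤ 1) (hB1 : ∀ i, ‖B i‖ ≤ 1) :
    WeakOperatorTendsto (fun i => opTensor (A i) (B i)) (opTensor A' B') := by
  refine weakOperatorTendsto_of_total (C := 1) (fun i => (norm_opTensor_le _ _).trans
    (mul_le_one₀ (hA1 i) (norm_nonneg _) (hB1 i))) span_lpTmul_dense ?_
  rintro _ ⟨f, g, rfl⟩ _ ⟨f', g', rfl⟩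
  simp only [opTensor_lpTmul, inner_lpTmul]
  exact (hA f f').mul (hB g g')

end Weak

/-! ### Koopman operators -/

section Koopman

variable {X Y : Type*} [MeasurableSpace X] [MeasurableSpace Y] {μ : Measure X} {ν : Measure Y}

/-- Needed because the group law of a `Z2Action` holds only modulo null sets. -/
theorem compMeasurePreserving_congr {f f' : X → X} (hf : MeasurePreserving f μ μ)
    (hf' : MeasurePreserving f' μ μ) (h : f =ᵐ[μ] f') (g : Lp ℂ 2 μ) :
    Lp.compMeasurePreserving f hf g = Lp.compMeasurePreserving f' hf' g := by
  refine Lp.ext ?_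
  filter_upwards [Lp.coeFn_compMeasurePreserving g hf, Lp.coeFn_compMeasurePreserving g hf', h]
    with x h1 h2 h3
  rw [h1, h2, Function.comp_apply, Function.comp_apply, h3]

theorem compMeasurePreserving_lpTmul [IsProbabilityMeasure μ] [IsProbabilityMeasure ν]
    {S : X → X} {T : Y → Y} (hS : MeasurePreserving S μ μ) (hT : MeasurePreserving T ν ν)
    (f : Lp ℂ 2 μ) (g : Lp ℂ 2 ν) :
    Lp.compMeasurePreserving (Prod.map S T) (hS.prod hT) (lpTmul f g) =
      lpTmul (Lp.compMeasurePreserving S hS f) (Lp.compMeasurePreserving T hT g) := by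
  refine Lp.ext ?_
  filter_upwards [Lp.coeFn_compMeasurePreserving (lpTmul f g) (hS.prod hT),
    coeFn_lpTmul (Lp.compMeasurePreserving S hS f) (Lp.compMeasurePreserving T hT g),
    (hS.prod hT).quasiMeasurePreserving.ae (coeFn_lpTmul f g),
    Measure.quasiMeasurePreserving_fst.ae (Lp.coeFn_compMeasurePreserving f hS),
    Measure.quasiMeasurePreserving_snd.ae (Lp.coeFn_compMeasurePreserving g hT)]
    with p h1 h2 h3 h4 h5
  rw [h1, h2, Function.comp_apply, h3, h4, h5]
  rfl

variable (μ) in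
/-- The constant function `1`. -/
abbrev lpOne [IsProbabilityMeasure μ] : Lp ℂ 2 μ := Lp.const 2 μ (1 : ℂ)

namespace Z2Action

theorem koopman_apply (S : Z2Action μ) (z : ℤ × ℤ) (g : Lp ℂ 2 μ) :
    S.koopman z g = Lp.compMeasurePreserving (S.map z) (S.measurePreserving z) g := rfl

theorem isUnitaryRep_koopman (S : Z2Action μ) : IsUnitaryRep S.koopman where
  zero := by
    ext1 g
    rw [koopman_apply, compMeasurePreserving_congr _ (MeasurePreserving.id μ) S.map_zero]
    simp
  add z z' := by
    ext1 g
    -- Passing to composition operators reverses the order of the maps; commutativity of `ℤ²`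
    -- restores it.
    rw [mul_apply_eq_comp, add_comm, koopman_apply, koopman_apply, koopman_apply,
      ← Lp.compMeasurePreserving_comp_apply]
    exact compMeasurePreserving_congr _ _ (S.map_add z' z).symm g
  inner_map z x y := LinearIsometry.inner_map_map _ x y

theorem norm_koopman_le (S : Z2Action μ) (z : ℤ × ℤ) : ‖S.koopman z‖ ≤ 1 :=
  LinearIsometry.norm_toContinuousLinearMap_le _

variable [IsProbabilityMeasure μ] [IsProbabilityMeasure ν]

theorem koopman_prod (S : Z2Action μ) (T : Z2Action ν) (z : ℤ × ℤ) :
    (S.prod T).koopman z = opTensor (S.koopman z) (T.koopman z) := by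
  refine ext_lpTmul fun f g => ?_
  rw [opTensor_lpTmul]
  exact compMeasurePreserving_lpTmul (S.measurePreserving z) (T.measurePreserving z) f g

theorem koopman_const (S : Z2Action μ) (z : ℤ × ℤ) :
    S.koopman z (lpOne μ) = lpOne μ := by
  refine Lp.ext ?_
  filter_upwards [Lp.coeFn_compMeasurePreserving (lpOne μ) (S.measurePreserving z),
    (S.measurePreserving z).quasiMeasurePreserving.ae (Lp.coeFn_const 2 μ (1 : ℂ)),
    Lp.coeFn_const 2 μ (1 : ℂ)] with x h1 h2 h3
  rw [koopman_apply, h1, Function.comp_apply, h2, h3]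
  rfl

end Z2Action

variable [IsProbabilityMeasure μ] [IsProbabilityMeasure ν]

theorem norm_lpOne : ‖lpOne μ‖ = 1 := by
  rw [lpOne, Lp.norm_const]
  · simp
  · exact two_ne_zero

theorem inner_lpOne_self : inner ℂ (lpOne μ) (lpOne μ) = 1 := by
  rw [inner_self_eq_norm_sq_to_K, norm_lpOne]
  simp

theorem lpTmul_lpOne : lpTmul (lpOne μ) (lpOne ν) = lpOne (μ.prod ν) := by
  refine Lp.ext ?_
  filter_upwards [coeFn_lpTmul (lpOne μ) (lpOne ν),
    Measure.quasiMeasurePreserving_fst.ae (Lp.coeFn_const 2 μ (1 : ℂ)),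
    Measure.quasiMeasurePreserving_snd.ae (Lp.coeFn_const 2 ν (1 : ℂ)),
    Lp.coeFn_const 2 (μ.prod ν) (1 : ℂ)] with p h1 h2 h3 h4
  rw [h1, h2, h3, h4]
  simp

theorem mem_L2Zero_iff {f : Lp ℂ 2 μ} : f ∈ L2Zero μ ↔ inner ℂ (lpOne μ) f = 0 :=
  Submodule.mem_orthogonal_singleton_iff_inner_right

theorem mem_L2Zero_iff' {f : Lp ℂ 2 μ} : f ∈ L2Zero μ ↔ inner ℂ f (lpOne μ) = 0 :=
  Submodule.mem_orthogonal_singleton_iff_inner_left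

theorem constProj_apply (f : Lp ℂ 2 μ) : constProj μ f = inner ℂ (lpOne μ) f • lpOne μ := by
  exact Submodule.starProjection_unit_singleton ℂ norm_lpOne f

/-- An ergodic transformation fixes only constants. -/
theorem mem_constSubspace_of_ergodic {S : X → X} (hS : Ergodic S μ) {f : Lp ℂ 2 μ}
    (hf : Lp.compMeasurePreserving S hS.toMeasurePreserving f = f) : f ∈ constSubspace μ := by
  have h1 := Lp.coeFn_compMeasurePreserving f hS.toMeasurePreserving
  rw [hf] at h1
  obtain ⟨c, hc⟩ := hS.ae_eq_const_of_ae_eq_comp_ae (Lp.aestronglyMeasurable f) h1.symm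
  refine Submodule.mem_span_singleton.2 ⟨c, Lp.ext ?_⟩
  filter_upwards [hc, Lp.coeFn_smul c (lpOne μ), Lp.coeFn_const 2 μ (1 : ℂ)] with x h2 h3 h4
  rw [h2, h3, Pi.smul_apply, h4]
  simp

theorem eq_zero_of_mem_const_of_mem_L2Zero {f : Lp ℂ 2 μ} (h : f ∈ constSubspace μ)
    (h0 : f ∈ L2Zero μ) : f = 0 :=
  inner_self_eq_zero.1 (Submodule.inner_right_of_mem_orthogonal h h0)

end Koopman

/-! ### Ergodicity of products -/

section Ergodic

variable {X Y : Type*} [MeasurableSpace X] [MeasurableSpace Y] {μ : Measure X} {ν : Measure Y}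
  [IsProbabilityMeasure μ] [IsProbabilityMeasure ν]

namespace Z2Action

/-- The only functions invariant under some `S^z`, `z ≠ 0`, are the constants. -/
def FixesOnlyConstants (S : Z2Action μ) : Prop :=
  ∀ z : ℤ × ℤ, z ≠ 0 → ∀ f, S.koopman z f = f → f ∈ constSubspace μ

theorem TotallyErgodic.fixesOnlyConstants {S : Z2Action μ} (hS : S.TotallyErgodic) :
    S.FixesOnlyConstants := fun z hz _ hf => mem_constSubspace_of_ergodic (hS z hz) hf

theorem FixesOnlyConstants.eq_zero {S : Z2Action μ} (hS : S.FixesOnlyConstants) {z : ℤ × ℤ}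
    (hz : z ≠ 0) {f : Lp ℂ 2 μ} (hf : S.koopman z f = f) (h0 : f ∈ L2Zero μ) : f = 0 :=
  eq_zero_of_mem_const_of_mem_L2Zero (hS z hz f hf) h0

theorem koopman_sub_mem_L2Zero (S : Z2Action μ) (z : ℤ × ℤ) (f : Lp ℂ 2 μ) :
    S.koopman z f - f ∈ L2Zero μ := by
  rw [mem_L2Zero_iff, inner_sub_right]
  nth_rw 1 [← S.koopman_const z]
  rw [S.isUnitaryRep_koopman.inner_map, sub_self]

theorem koopman_mem_L2Zero (S : Z2Action μ) (z : ℤ × ℤ) {f : Lp ℂ 2 μ} (hf : f ∈ L2Zero μ) :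
    S.koopman z f ∈ L2Zero μ := by
  simpa using (L2Zero μ).add_mem (S.koopman_sub_mem_L2Zero z f) hf

theorem sub_inner_smul_mem_L2Zero (f : Lp ℂ 2 μ) :
    f - inner ℂ (lpOne μ) f • lpOne μ ∈ L2Zero μ := by
  rw [mem_L2Zero_iff, inner_sub_right, inner_smul_right, inner_lpOne_self, mul_one, sub_self]

theorem mem_constSubspace_of_forall {f : Lp ℂ 2 μ}
    (h : f - inner ℂ (lpOne μ) f • lpOne μ = 0) : f ∈ constSubspace μ :=
  Submodule.mem_span_singleton.2 ⟨_, (sub_eq_zero.1 h).symm⟩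

/-- An invariant `f`, with its mean removed, lifts to the invariant zero mean function `f₀ ⊗ 1` of
the product. -/
theorem FixesOnlyConstants.fst {S : Z2Action μ} {T : Z2Action ν}
    (h : (S.prod T).FixesOnlyConstants) : S.FixesOnlyConstants := by
  intro z hz f hf
  refine mem_constSubspace_of_forall ?_
  set f₀ := f - inner ℂ (lpOne μ) f • lpOne μ
  have h0 : S.koopman z f₀ = f₀ := by rw [map_sub, map_smul, hf, S.koopman_const]
  have h1 : lpTmul f₀ (lpOne ν) = 0 := by
    refine h.eq_zero hz (by rw [koopman_prod, opTensor_lpTmul, h0, T.koopman_const]) ?_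
    rw [mem_L2Zero_iff, ← lpTmul_lpOne, inner_lpTmul,
      mem_L2Zero_iff.1 (sub_inner_smul_mem_L2Zero f), zero_mul]
  have h2 := inner_lpTmul f₀ f₀ (lpOne ν) (lpOne ν)
  rw [h1, inner_zero_left, inner_lpOne_self, mul_one] at h2
  exact inner_self_eq_zero.1 h2.symm

theorem FixesOnlyConstants.snd {S : Z2Action μ} {T : Z2Action ν}
    (h : (S.prod T).FixesOnlyConstants) : T.FixesOnlyConstants := by
  intro z hz f hf
  refine mem_constSubspace_of_forall ?_
  set f₀ := f - inner ℂ (lpOne ν) f • lpOne ν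
  have h0 : T.koopman z f₀ = f₀ := by rw [map_sub, map_smul, hf, T.koopman_const]
  have h1 : lpTmul (lpOne μ) f₀ = 0 := by
    refine h.eq_zero hz (by rw [koopman_prod, opTensor_lpTmul, h0, S.koopman_const]) ?_
    rw [mem_L2Zero_iff, ← lpTmul_lpOne, inner_lpTmul,
      mem_L2Zero_iff.1 (sub_inner_smul_mem_L2Zero f), mul_zero]
  have h2 := inner_lpTmul (lpOne μ) (lpOne μ) f₀ f₀
  rw [h1, inner_zero_left, inner_lpOne_self, one_mul] at h2
  exact inner_self_eq_zero.1 h2.symm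

end Z2Action

/-- Independent exponents are allowed because `R^z × R^{-z}` does not belong to the diagonal action.
-/
theorem Z2Action.opTensor_koopman_apply (S : Z2Action μ) (T : Z2Action ν) (z z' : ℤ × ℤ)
    (F : Lp ℂ 2 (μ.prod ν)) :
    opTensor (S.koopman z) (T.koopman z') F = Lp.compMeasurePreserving (Prod.map (S.map z) (T.map z'))
      ((S.measurePreserving z).prod (T.measurePreserving z')) F := by
  have h : opTensor (S.koopman z) (T.koopman z') =
      (Lp.compMeasurePreservingₗᵢ ℂ (Prod.map (S.map z) (T.map z'))
        ((S.measurePreserving z).prod (T.measurePreserving z'))).toContinuousLinearMap := by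
    refine ext_lpTmul fun f g => ?_
    rw [opTensor_lpTmul]
    exact (compMeasurePreserving_lpTmul (S.measurePreserving z)
      (T.measurePreserving z') f g).symm
  rw [h]
  rfl

/-- If the overlaps of the sections of `E` are almost surely constant, then `1_E` is orthogonal to
`φ(x) ψ(y)` whenever `φ` has zero mean. -/
theorem inner_lpTmul_indicator_eq_zero {E : Set (X × Y)} (hE : MeasurableSet E) {c : ℂ}
    (hc : ∀ᵐ q : X × X ∂μ.prod μ, ∫ y, E.indicator (1 : X × Y → ℂ) (q.1, y) *
      E.indicator (1 : X × Y → ℂ) (q.2, y) ∂ν = c)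
    {φ : Lp ℂ 2 μ} (hφ : φ ∈ L2Zero μ) (ψ : Lp ℂ 2 ν) :
    inner ℂ (lpTmul φ ψ) (indicatorConstLp 2 hE (measure_ne_top (μ.prod ν) E) (1 : ℂ)) = 0 := by
  set χ : X × Y → ℂ := E.indicator 1 with hχ
  have hχm : Measurable χ := measurable_one.indicator hE
  have hχb : ∀ p, ‖χ p‖ ≤ 1 := fun p => by
    by_cases hp : p ∈ E <;> simp [hχ, hp]
  have hχc : ∀ p, starRingEnd ℂ (χ p) = χ p := fun p => by
    by_cases hp : p ∈ E <;> simp [hχ, hp]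
  have hφi : Integrable φ μ := (Lp.memLp φ).integrable (by norm_num)
  have hψi : Integrable ψ ν := (Lp.memLp ψ).integrable (by norm_num)
  have hφci : Integrable (fun x => starRingEnd ℂ (φ x)) μ :=
    (Complex.conjCLE : ℂ →L[ℝ] ℂ).integrable_comp hφi
  have hψci : Integrable (fun x => starRingEnd ℂ (ψ x)) ν :=
    (Complex.conjCLE : ℂ →L[ℝ] ℂ).integrable_comp hψi
  have hmean : ∫ x, φ x ∂μ = 0 := by
    have := mem_L2Zero_iff.1 hφ
    rw [L2.inner_def] at this
    rw [← this]
    refine integral_congr_ae ?_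
    filter_upwards [Lp.coeFn_const 2 μ (1 : ℂ)] with x hx
    rw [hx]
    simp
  -- The inner product in question is the integral of `conj ψ · q`, so it suffices that `q` vanishes
  -- almost everywhere.
  set q : Y → ℂ := fun y => ∫ x, starRingEnd ℂ (φ x) * χ (x, y) ∂μ with hq
  have hbd : Integrable (fun p : X × Y => starRingEnd ℂ (φ p.1) * χ p) (μ.prod ν) :=
    (hφci.comp_fst ν).mul_bdd (c := 1) hχm.aestronglyMeasurable (.of_forall hχb)
  have hqi : Integrable q ν := hbd.integral_prod_right
  have hqb : ∀ y, ‖q y‖ ≤ ∫ x, ‖φ x‖ ∂μ := fun y => by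
    refine norm_integral_le_of_norm_le hφi.norm (.of_forall fun x => ?_)
    rw [norm_mul, RCLike.norm_conj]
    exact mul_le_of_le_one_right (norm_nonneg _) (hχb _)
  have hqc : ∀ y, starRingEnd ℂ (q y) = ∫ x, φ x * χ (x, y) ∂μ := fun y => by
    rw [hq, ← integral_conj]
    simp [hχc]
  -- By Fubini, `‖q‖²` is the integral of `conj φ(x) φ(x')` against the overlap of the sections at
  -- `x` and `x'`. As the overlap is the constant `c`, the integral factors through the mean of `φ`,
  -- which is zero.
  have hsq : ∫ y, q y * starRingEnd ℂ (q y) ∂ν = 0 := by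
    have hK : Integrable (Function.uncurry fun (p : X × X) (y : Y) =>
        (starRingEnd ℂ (φ p.1) * φ p.2) * (χ (p.1, y) * χ (p.2, y))) ((μ.prod μ).prod ν) := by
      refine ((hφci.mul_prod hφi).comp_fst ν).mul_bdd (c := 1) (Measurable.aestronglyMeasurable ?_)
        (.of_forall fun p => ?_)
      · exact (hχm.comp ((measurable_fst.comp measurable_fst).prodMk measurable_snd)).mul
          (hχm.comp ((measurable_snd.comp measurable_fst).prodMk measurable_snd))
      · rw [norm_mul]
        exact mul_le_one₀ (hχb _) (norm_nonneg _) (hχb _)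
    calc ∫ y, q y * starRingEnd ℂ (q y) ∂ν
        = ∫ y, ∫ p : X × X, (starRingEnd ℂ (φ p.1) * φ p.2) * (χ (p.1, y) * χ (p.2, y))
            ∂μ.prod μ ∂ν := by
          refine integral_congr_ae (.of_forall fun y => ?_)
          simp only [hqc]
          rw [hq, ← integral_prod_mul]
          refine integral_congr_ae (.of_forall fun p => ?_)
          ring
      _ = ∫ p : X × X, ∫ y, (starRingEnd ℂ (φ p.1) * φ p.2) * (χ (p.1, y) * χ (p.2, y))
            ∂ν ∂μ.prod μ := (integral_integral_swap hK).symm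
      _ = ∫ p : X × X, starRingEnd ℂ (φ p.1) * (φ p.2 * c) ∂μ.prod μ := by
          refine integral_congr_ae ?_
          filter_upwards [hc] with p hp
          rw [integral_const_mul, hp, mul_assoc]
      _ = 0 := by
          rw [integral_prod_mul (fun x => starRingEnd ℂ (φ x)) (fun x => φ x * c),
            integral_mul_const, hmean, zero_mul, mul_zero]
  have hq0 : q =ᵐ[ν] 0 := by
    have h1 : ∫ y, ‖q y‖ ^ 2 ∂ν = 0 := by
      rw [← Complex.ofReal_inj, ← integral_complex_ofReal, Complex.ofReal_zero, ← hsq]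
      refine integral_congr_ae (.of_forall fun y => ?_)
      simp only [Complex.mul_conj, Complex.normSq_eq_norm_sq]
    have hi : Integrable (fun y => ‖q y‖ ^ 2) ν :=
      Integrable.of_bound (hqi.1.norm.pow 2) ((∫ x, ‖φ x‖ ∂μ) ^ 2) (.of_forall fun y => by
        rw [norm_pow, norm_norm]
        exact pow_le_pow_left₀ (norm_nonneg _) (hqb y) 2)
    rw [integral_eq_zero_iff_of_nonneg (fun y => by positivity) hi] at h1
    filter_upwards [h1] with y hy
    simpa using hy
  have hF_int : Integrable (fun p : X × Y => (starRingEnd ℂ (φ p.1) * starRingEnd ℂ (ψ p.2)) * χ p)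
      (μ.prod ν) :=
    (hφci.mul_prod hψci).mul_bdd (c := 1) hχm.aestronglyMeasurable (.of_forall hχb)
  rw [L2.inner_def]
  calc _ = ∫ p : X × Y, (starRingEnd ℂ (φ p.1) * starRingEnd ℂ (ψ p.2)) * χ p ∂μ.prod ν := by
        refine integral_congr_ae ?_
        filter_upwards [coeFn_lpTmul φ ψ, indicatorConstLp_coeFn (p := 2) (hs := hE)
          (hμs := measure_ne_top (μ.prod ν) E) (c := (1 : ℂ))] with p h1 h2
        rw [h1, h2]
        simp only [RCLike.inner_apply, map_mul]
        rw [mul_comm]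
        rfl
    _ = ∫ y, ∫ x, (starRingEnd ℂ (φ x) * starRingEnd ℂ (ψ y)) * χ (x, y) ∂μ ∂ν :=
        integral_prod_symm _ hF_int
    _ = ∫ y, 0 ∂ν := by
        refine integral_congr_ae ?_
        filter_upwards [hq0] with y hy
        have : ∀ x, (starRingEnd ℂ (φ x) * starRingEnd ℂ (ψ y)) * χ (x, y) =
          starRingEnd ℂ (ψ y) * (starRingEnd ℂ (φ x) * χ (x, y)) := fun x => by ring
        simp only [this, integral_const_mul]
        change _ * q y = 0
        rw [hy, Pi.zero_apply, mul_zero]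
    _ = 0 := by simp

/-- If `R × R` fixes only constants then `R^z × R^{-z}` is ergodic for `z ≠ 0`. -/
theorem Z2Action.ergodic_skew {R : Z2Action μ} (hR : (R.prod R).FixesOnlyConstants)
    {z : ℤ × ℤ} (hz : z ≠ 0) :
    Ergodic (Prod.map (R.map z) (R.map (-z))) (μ.prod μ) := by
  have hmp : MeasurePreserving (Prod.map (R.map z) (R.map (-z))) (μ.prod μ) (μ.prod μ) :=
    (R.measurePreserving z).prod (R.measurePreserving (-z))
  refine ⟨hmp, ⟨fun E hE hinv => ?_⟩⟩
  have hU := R.isUnitaryRep_koopman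
  set χ : X × X → ℂ := E.indicator 1 with hχ
  have hχm : Measurable χ := measurable_one.indicator hE
  have hχb : ∀ p, ‖χ p‖ ≤ 1 := fun p => by
    by_cases hp : p ∈ E <;> simp [hχ, hp]
  have hχinv : ∀ x y, χ (R.map z x, R.map (-z) y) = χ (x, y) := by
    intro x y
    have : (R.map z x, R.map (-z) y) ∈ E ↔ (x, y) ∈ E := by
      conv_rhs => rw [← hinv]
      rfl
    by_cases hp : (x, y) ∈ E
    · simp [hχ, hp, this.2 hp]
    · simp [hχ, hp, mt this.1 hp]
  -- The overlap of two sections of `E`. Substituting `y ↦ R^{-z} y` and using invariance of `E`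
  -- makes `G` invariant under `R^z × R^z`, so it is almost everywhere constant.
  let G : X × X → ℂ := fun q => ∫ y, χ (q.1, y) * χ (q.2, y) ∂μ
  have hKm : Measurable (fun p : (X × X) × X => χ (p.1.1, p.2) * χ (p.1.2, p.2)) :=
    (hχm.comp ((measurable_fst.comp measurable_fst).prodMk measurable_snd)).mul
      (hχm.comp ((measurable_snd.comp measurable_fst).prodMk measurable_snd))
  have hGm : StronglyMeasurable G := hKm.stronglyMeasurable.integral_prod_right
  have hGb : ∀ q, ‖G q‖ ≤ 1 := fun q => by
    refine (norm_integral_le_of_norm_le_const (C := 1) (.of_forall fun y => ?_)).trans (by simp)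
    rw [norm_mul]
    exact mul_le_one₀ (hχb _) (norm_nonneg _) (hχb _)
  have hGL : MemLp G 2 (μ.prod μ) := MemLp.of_bound hGm.aestronglyMeasurable 1 (.of_forall hGb)
  have hGinv : ∀ q : X × X, G (R.map z q.1, R.map z q.2) = G q := by
    intro q
    have hm : AEStronglyMeasurable (fun y => χ (R.map z q.1, y) * χ (R.map z q.2, y))
        (μ.map (R.map (-z))) :=
      ((hχm.comp measurable_prodMk_left).mul (hχm.comp measurable_prodMk_left)).aestronglyMeasurable
    have h1 := integral_map (R.measurePreserving (-z)).aemeasurable hm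
    rw [(R.measurePreserving (-z)).map_eq] at h1
    simp only [hχinv] at h1
    exact h1
  obtain ⟨c, hc⟩ : ∃ c : ℂ, ∀ᵐ q ∂μ.prod μ, G q = c := by
    have h1 : hGL.toLp G ∈ constSubspace (μ.prod μ) := by
      refine hR z hz _ ?_
      rw [koopman_apply, Lp.toLp_compMeasurePreserving]
      refine MemLp.toLp_congr _ _ (.of_forall hGinv)
    obtain ⟨c, hc⟩ := Submodule.mem_span_singleton.1 h1
    refine ⟨c, ?_⟩
    filter_upwards [hGL.coeFn_toLp, Lp.coeFn_smul c (lpOne (μ.prod μ)),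
      Lp.coeFn_const 2 (μ.prod μ) (1 : ℂ)] with q h1 h2 h3
    rw [← h1, ← hc, h2, Pi.smul_apply, h3]
    simp
  set F := indicatorConstLp 2 hE (measure_ne_top (μ.prod μ) E) (1 : ℂ) with hF
  have horth : ∀ φ ∈ L2Zero μ, ∀ ψ : Lp ℂ 2 μ, inner ℂ (lpTmul φ ψ) F = 0 := fun φ hφ ψ =>
    inner_lpTmul_indicator_eq_zero hE hc hφ ψ
  -- `F` is orthogonal to every `φ ⊗ ψ` with `φ` of zero mean, so it depends on the second variable
  -- only.
  have h1 : opTensor (R.koopman z) 1 F = F := by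
    rw [← sub_eq_zero]
    refine eq_zero_of_inner_lpTmul fun f g => ?_
    have h2 := ContinuousLinearMap.adjoint_inner_left (opTensor (R.koopman z) 1) F (lpTmul f g)
    rw [← ContinuousLinearMap.star_eq_adjoint, star_opTensor, hU.star_eq, opTensor_lpTmul,
      star_one] at h2
    rw [inner_sub_right, ← h2, ← inner_sub_left]
    change inner ℂ (lpTmul _ g - _) F = 0
    rw [← LinearMap.sub_apply, ← map_sub]
    exact horth _ (R.koopman_sub_mem_L2Zero _ _) _
  have h2 : opTensor (R.koopman z) (R.koopman (-z)) F = F := by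
    rw [opTensor_koopman_apply]
    rw [hF, Lp.indicatorConstLp_compMeasurePreserving]
    congr 1
  have h3 : opTensor (R.koopman z) (R.koopman z) F = F := by
    -- `V ⊗ V = (V ⊗ 1)² (V⁻¹ ⊗ V)`, and each factor on the right fixes `F`.
    have e1 : opTensor (R.koopman z) (R.koopman z) =
        opTensor (R.koopman z) 1 * opTensor (R.koopman z) 1 *
          opTensor (R.koopman (-z)) (R.koopman z) := by
      rw [opTensor_mul, opTensor_mul, mul_assoc, ← hU.add, add_neg_cancel, hU.zero]
      simp
    have e2 : opTensor (R.koopman (-z)) (R.koopman z) F = F := by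
      conv_lhs => rw [← h2]
      rw [← mul_apply_eq_comp, opTensor_mul, ← hU.add, ← hU.add, neg_add_cancel, add_neg_cancel,
        hU.zero, opTensor_one]
      rfl
    rw [e1, mul_apply_eq_comp, mul_apply_eq_comp, e2, h1, h1]
  have h4 : F ∈ constSubspace (μ.prod μ) := hR z hz F (by rw [koopman_prod, h3])
  obtain ⟨c, hc⟩ := Submodule.mem_span_singleton.1 h4
  have h5 : χ =ᵐ[μ.prod μ] fun _ => c := by
    filter_upwards [indicatorConstLp_coeFn (p := 2) (hs := hE)
      (hμs := measure_ne_top (μ.prod μ) E) (c := (1 : ℂ)), Lp.coeFn_smul c (lpOne (μ.prod μ)),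
      Lp.coeFn_const 2 (μ.prod μ) (1 : ℂ)] with p h1 h2 h3
    have h1' : F p = χ p := h1
    rw [← h1', ← hc, h2, Pi.smul_apply, h3]
    simp
  rw [eventuallyConst_set']
  by_cases hc1 : c = 1
  · right
    filter_upwards [h5] with p hp
    refine propext ⟨fun _ => trivial, fun _ => ?_⟩
    by_contra hpE
    rw [hχ, Set.indicator_of_notMem hpE, hc1] at hp
    exact zero_ne_one hp
  · left
    filter_upwards [h5] with p hp
    refine propext ⟨fun hpE => ?_, fun h => h.elim⟩
    have hpE' : p ∈ E := hpE
    rw [hχ, Set.indicator_of_mem hpE'] at hp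
    exact hc1 hp.symm

end Ergodic

/-! ### Symmetric and antisymmetric functions -/

section Swap

variable {X : Type*} [MeasurableSpace X] (μ : Measure X) [IsProbabilityMeasure μ]

/-- The operator `g(x, y) ↦ g(y, x)`. -/
def swapOp : Lp ℂ 2 (μ.prod μ) →L[ℂ] Lp ℂ 2 (μ.prod μ) :=
  (Lp.compMeasurePreservingₗᵢ ℂ (Prod.swap : X × X → X × X)
      (Measure.measurePreserving_swap (μ := μ) (ν := μ))).toContinuousLinearMap

/-- The functions with `g(y, x) = -g(x, y)`. -/
def antiSubspace : Submodule ℂ (Lp ℂ 2 (μ.prod μ)) :=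
  LinearMap.eqLocus (swapOp μ).toLinearMap (-LinearMap.id)

variable {μ}

theorem mem_symmSubspace {g : Lp ℂ 2 (μ.prod μ)} : g ∈ symmSubspace μ ↔ swapOp μ g = g := Iff.rfl

theorem mem_antiSubspace {g : Lp ℂ 2 (μ.prod μ)} : g ∈ antiSubspace μ ↔ swapOp μ g = -g := Iff.rfl

theorem swapOp_lpTmul (f g : Lp ℂ 2 μ) : swapOp μ (lpTmul f g) = lpTmul g f := by
  refine Lp.ext ?_
  have hs := Measure.measurePreserving_swap (μ := μ) (ν := μ)
  filter_upwards [Lp.coeFn_compMeasurePreserving (lpTmul f g) hs, coeFn_lpTmul g f,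
    hs.quasiMeasurePreserving.ae (coeFn_lpTmul f g)] with p h1 h2 h3
  refine h1.trans ?_
  rw [h2, Function.comp_apply, h3]
  exact mul_comm _ _

theorem swapOp_mul_self : swapOp μ * swapOp μ = 1 :=
  ext_lpTmul fun f g => by
    rw [mul_apply_eq_comp, swapOp_lpTmul, swapOp_lpTmul]; rfl

theorem swapOp_swapOp (g : Lp ℂ 2 (μ.prod μ)) : swapOp μ (swapOp μ g) = g :=
  DFunLike.congr_fun swapOp_mul_self g

theorem inner_swapOp_swapOp (f g : Lp ℂ 2 (μ.prod μ)) :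
    inner ℂ (swapOp μ f) (swapOp μ g) = inner ℂ f g :=
  LinearIsometry.inner_map_map _ f g

theorem star_swapOp : star (swapOp μ) = swapOp μ := by
  rw [ContinuousLinearMap.star_eq_adjoint]
  refine (ContinuousLinearMap.eq_adjoint_iff _ _).2 (fun x y => ?_) |>.symm
  rw [← inner_swapOp_swapOp, swapOp_swapOp]

theorem swapOp_mul_opTensor (A B : Lp ℂ 2 μ →L[ℂ] Lp ℂ 2 μ) :
    swapOp μ * opTensor A B = opTensor B A * swapOp μ :=
  ext_lpTmul fun f g => by
    simp only [mul_apply_eq_comp, swapOp_lpTmul, opTensor_lpTmul]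

theorem swapOp_lpOne : swapOp μ (lpOne (μ.prod μ)) = lpOne (μ.prod μ) := by
  rw [← lpTmul_lpOne, swapOp_lpTmul]

theorem inner_symm_anti {f g : Lp ℂ 2 (μ.prod μ)} (hf : swapOp μ f = f) (hg : swapOp μ g = -g) :
    inner ℂ f g = 0 := by
  have h := inner_swapOp_swapOp f g
  rw [hf, hg, inner_neg_right] at h
  linear_combination (-1 / 2 : ℂ) * h

theorem antiSubspace_le_L2Zero : antiSubspace μ ≤ L2Zero (μ.prod μ) := fun _ hg =>
  mem_L2Zero_iff.2 (inner_symm_anti swapOp_lpOne hg)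

theorem isClosed_antiSubspace : IsClosed (antiSubspace μ : Set (Lp ℂ 2 (μ.prod μ))) :=
  isClosed_eq (swapOp μ).continuous continuous_neg

/-- Functions with zero mean are sums of symmetric and antisymmetric ones with zero mean. -/
theorem exists_symm_add_anti {g : Lp ℂ 2 (μ.prod μ)} (hg : g ∈ L2Zero (μ.prod μ)) :
    ∃ s ∈ symmSubspace μ ⊓ L2Zero (μ.prod μ), ∃ a ∈ antiSubspace μ, g = s + a := by
  have hF : swapOp μ g ∈ L2Zero (μ.prod μ) := by
    rw [mem_L2Zero_iff, ← swapOp_lpOne, inner_swapOp_swapOp]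
    exact mem_L2Zero_iff.1 hg
  refine ⟨(1 / 2 : ℂ) • (g + swapOp μ g), ⟨?_, ?_⟩, (1 / 2 : ℂ) • (g - swapOp μ g), ?_, ?_⟩
  · rw [SetLike.mem_coe, mem_symmSubspace, map_smul, map_add, swapOp_swapOp, add_comm]
  · exact (L2Zero _).smul_mem _ ((L2Zero _).add_mem hg hF)
  · rw [mem_antiSubspace, map_smul, map_sub, swapOp_swapOp, ← smul_neg, neg_sub]
  · module

namespace Z2Action

/-- If the symmetric square has simple spectrum, then the antisymmetric functions form a cyclic
subspace, isomorphic to the space of symmetric functions with zero mean. -/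
theorem SymmSquareHasSimpleSpectrum.exists_generators {R : Z2Action μ}
    (hsimple : R.SymmSquareHasSimpleSpectrum) (hR : (R.prod R).FixesOnlyConstants) :
    ∃ h : Fin 2 → Lp ℂ 2 (μ.prod μ),
      cyclicSpan (R.prod R).koopman (h 0) = symmSubspace μ ⊓ L2Zero (μ.prod μ) ∧
      cyclicSpan (R.prod R).koopman (h 1) = antiSubspace μ ∧
      ∀ z, inner ℂ ((R.prod R).koopman z (h 1)) (h 1) =
        inner ℂ ((R.prod R).koopman z (h 0)) (h 0) := by
  obtain ⟨h, hh⟩ := hsimple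
  have hU := R.isUnitaryRep_koopman
  have hUU := (R.prod R).isUnitaryRep_koopman
  have he : ((1, 0) : ℤ × ℤ) ≠ 0 := by simp
  set V := R.koopman (1, 0)
  set V' := R.koopman (-(1, 0))
  have hVV' : V * V' = 1 := by rw [← hU.add, add_neg_cancel, hU.zero]
  have hV'V : V' * V = 1 := by rw [← hU.add, neg_add_cancel, hU.zero]
  have hsV : star V = V' := hU.star_eq _
  -- The flip exchanges the two terms, so `D` maps symmetric functions to antisymmetric ones.
  -- Multiplying by `1 ⊗ V⁻¹` identifies its kernel with the fixed vectors of `V ⊗ V⁻¹`.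
  set D := opTensor V 1 - opTensor 1 V with hD
  have hDU : ∀ z, Commute D ((R.prod R).koopman z) := by
    intro z
    rw [koopman_prod]
    have hc := (hU.commute (1, 0) z).eq
    refine Commute.sub_left ?_ ?_ <;>
      rw [Commute, SemiconjBy, opTensor_mul, opTensor_mul, hc, mul_one, one_mul]
  have hFD : swapOp μ * D = -(D * swapOp μ) := by
    rw [hD, mul_sub, swapOp_mul_opTensor, swapOp_mul_opTensor, sub_mul, neg_sub]
  have hDF : star D * swapOp μ = -(swapOp μ * star D) := by
    have := congrArg star hFD
    rwa [star_mul, star_neg, star_mul, star_swapOp] at this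
  have hD1 : D (lpOne (μ.prod μ)) = 0 := by
    rw [← lpTmul_lpOne, hD, sub_apply, opTensor_lpTmul, opTensor_lpTmul, R.koopman_const]
    exact sub_self _
  have hkerD : ∀ x, D x = 0 → x ∈ constSubspace (μ.prod μ) := by
    intro x hx
    have h1 : opTensor V V' x = x := by
      have h2 : opTensor 1 V' (D x) = 0 := by rw [hx, _root_.map_zero]
      rw [← mul_apply_eq_comp, hD, mul_sub, opTensor_mul, opTensor_mul, hV'V, one_mul, mul_one,
        one_mul, opTensor_one, sub_apply, sub_eq_zero] at h2
      exact h2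
    refine mem_constSubspace_of_ergodic (ergodic_skew hR he) ?_
    rw [← opTensor_koopman_apply]
    exact h1
  have hker : ∀ x ∈ L2Zero (μ.prod μ), D x = 0 → x = 0 := fun x h0 hx =>
    eq_zero_of_mem_const_of_mem_L2Zero (hkerD x hx) h0
  obtain ⟨h', hh', hcorr⟩ := hUU.exists_cyclic_map (h := h) hDU
    (fun x hx => hker x (hh.le hx).2)
  refine ⟨![h, h'], hh, ?_, hcorr⟩
  set M := (cyclicSpan (R.prod R).koopman h).map D.toLinearMap with hM
  have : CompleteSpace M.topologicalClosure :=
    (Submodule.isClosed_topologicalClosure _).completeSpace_coe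
  have hMle : M.topologicalClosure ≤ antiSubspace μ := by
    refine Submodule.topologicalClosure_minimal _ ?_ isClosed_antiSubspace
    rintro _ ⟨x, hx, rfl⟩
    rw [SetLike.mem_coe, hh] at hx
    have h1 := DFunLike.congr_fun hFD x
    rw [mul_apply_eq_comp] at h1
    refine mem_antiSubspace.2 (h1.trans ?_)
    rw [neg_apply, mul_apply_eq_comp, mem_symmSubspace.1 hx.1]
    rfl
  refine hh'.trans (le_antisymm hMle ?_)
  · intro y hy
    -- The part of `y` missed by the image of `D`. As `D* w` is symmetric of zero mean, `D D* w`
    -- lies in `M`, which is orthogonal to `w`; hence `D* w = 0`.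
    set w := y - M.topologicalClosure.starProjection y with hw
    have hwa : w ∈ antiSubspace μ :=
      Submodule.sub_mem _ hy (hMle (Submodule.starProjection_apply_mem _ _))
    have hwo : w ∈ M.topologicalClosureᗮ := Submodule.sub_starProjection_mem_orthogonal _
    have hs0 : star D w ∈ symmSubspace μ ⊓ L2Zero (μ.prod μ) := by
      refine ⟨?_, ?_⟩
      · have h1 := DFunLike.congr_fun hDF w
        rw [mul_apply_eq_comp, mem_antiSubspace.1 hwa, neg_apply, mul_apply_eq_comp, map_neg,
          neg_inj] at h1
        exact mem_symmSubspace.2 h1.symm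
      · refine mem_L2Zero_iff.2 ?_
        rw [ContinuousLinearMap.star_eq_adjoint, ContinuousLinearMap.adjoint_inner_right, hD1,
          inner_zero_left]
    have hs1 : star D w = 0 := by
      rw [← inner_self_eq_zero (𝕜 := ℂ)]
      nth_rw 2 [ContinuousLinearMap.star_eq_adjoint]
      rw [ContinuousLinearMap.adjoint_inner_right]
      have hmem : D (star D w) ∈ M := ⟨_, hh.ge hs0, rfl⟩
      exact Submodule.inner_right_of_mem_orthogonal (M.le_topologicalClosure hmem) hwo
    -- `(V ⊗ V) D* = -D`, so `D*` and `D` have the same kernel.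
    have hs2 : D w = 0 := by
      have h2 : opTensor V V (star D w) = 0 := by rw [hs1, _root_.map_zero]
      rw [← mul_apply_eq_comp, hD, star_sub, star_opTensor, star_opTensor, hsV, star_one, mul_sub,
        opTensor_mul, opTensor_mul, hVV', mul_one, sub_apply, sub_eq_zero] at h2
      rw [hD, sub_apply, h2, sub_self]
    have hw0 : w = 0 := hker w (antiSubspace_le_L2Zero hwa) hs2
    rw [sub_eq_zero.1 hw0]
    exact Submodule.starProjection_apply_mem _ _

end Z2Action

end Swap

/-! ### Orthogonal sums of cyclic subspaces -/

section Sums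

variable {H : Type*} [NormedAddCommGroup H] [InnerProductSpace ℂ H] {U : ℤ × ℤ → H →L[ℂ] H}

/-- The closed sum of the cyclic subspaces generated by the vectors `g i`. -/
def cyclicSum (U : ℤ × ℤ → H →L[ℂ] H) {ι : Type*} (g : ι → H) : Submodule ℂ H :=
  (⨆ i, cyclicSpan U (g i)).topologicalClosure

theorem isClosed_cyclicSum {ι : Type*} (g : ι → H) : IsClosed (cyclicSum U g : Set H) :=
  Submodule.isClosed_topologicalClosure _

theorem cyclicSpan_le_cyclicSum {ι : Type*} (g : ι → H) (i : ι) :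
    cyclicSpan U (g i) ≤ cyclicSum U g :=
  (le_iSup (fun i => cyclicSpan U (g i)) i).trans (Submodule.le_topologicalClosure _)

theorem cyclicSum_le {ι : Type*} {g : ι → H} {K : Submodule ℂ H} (hK : IsClosed (K : Set H))
    (h : ∀ i z, U z (g i) ∈ K) : cyclicSum U g ≤ K :=
  Submodule.topologicalClosure_minimal _ (iSup_le fun i => cyclicSpan_le hK (h i)) hK

theorem cyclicSum_isOrtho {ι κ : Type*} {g : ι → H} {g' : κ → H}
    (h : ∀ i j z z', inner ℂ (U z (g i)) (U z' (g' j)) = 0) : cyclicSum U g ⟂ cyclicSum U g' := by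
  rw [Submodule.isOrtho_iff_le]
  refine cyclicSum_le (Submodule.isClosed_orthogonal _) fun i z => ?_
  rw [cyclicSum, Submodule.orthogonal_closure, ← Submodule.iInf_orthogonal, Submodule.mem_iInf]
  intro j
  rw [cyclicSpan, Submodule.orthogonal_closure, Submodule.mem_orthogonal']
  intro x hx
  induction hx using Submodule.span_induction with
  | mem x hx => obtain ⟨z', rfl⟩ := hx; exact h i j z z'
  | zero => simp
  | add x y _ _ hx hy => rw [inner_add_right, hx, hy, add_zero]
  | smul c x _ hx => rw [inner_smul_right, hx, mul_zero]

namespace IsUnitaryRep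

theorem map_mem_cyclicSum (hU : IsUnitaryRep U) {ι : Type*} {g : ι → H} (z : ℤ × ℤ) {x : H}
    (hx : x ∈ cyclicSum U g) : U z x ∈ cyclicSum U g := by
  have : cyclicSum U g ≤ (cyclicSum U g).comap (U z).toLinearMap :=
    cyclicSum_le (isClosed_comap (isClosed_cyclicSum g) _) fun i z' =>
      cyclicSpan_le_cyclicSum g i (hU.map_mem_cyclicSpan z (mem_cyclicSpan_orbit z' _))
  exact this hx

/-- Equal correlations make the cyclic pieces isomorphic. The index type is left free so that `Fin 2
× Fin 2` can index the part of multiplicity four. -/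
theorem hasHomogeneousSpectrum [CompleteSpace H] (hU : IsUnitaryRep U) {ι : Type*} {n : ℕ}
    (hn : 1 ≤ n) (e : ι ≃ Fin n) {g : ι → H}
    (hort : ∀ i j, i ≠ j → ∀ z z', inner ℂ (U z (g i)) (U z' (g j)) = 0)
    (hcorr : ∀ i j z, inner ℂ (U z (g i)) (g i) = inner ℂ (U z (g j)) (g j)) :
    HasHomogeneousSpectrum U (cyclicSum U g) n := by
  let e' : {i : ℕ // (i : ℕ∞) < n} ≃ ι :=
    { toFun := fun i => e.symm ⟨i, by exact_mod_cast i.2⟩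
      invFun := fun i => ⟨e i, by exact_mod_cast (e i).2⟩
      left_inv := fun i => by simp
      right_inv := fun i => by simp }
  refine ⟨by exact_mod_cast hn, fun i => cyclicSpan U (g (e' i)), fun i => ⟨_, rfl⟩,
    fun i j hij => cyclicSpan_isOrtho (hort _ _ fun h => hij (e'.injective h)), ?_,
    fun i j => hU.restrictionsIsomorphic (hcorr _ _)⟩
  rw [cyclicSum, e'.iSup_comp (g := fun i => cyclicSpan U (g i))]

/-- The extension by zero of an intertwining operator between invariant subspaces commutes with
the representation. -/
theorem commute_extension (hU : IsUnitaryRep U) {K L : Submodule ℂ H}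
    [K.HasOrthogonalProjection] (hK : ∀ z, ∀ x ∈ K, U z x ∈ K) {J : K →L[ℂ] L}
    (hJ : Intertwines U J) (z : ℤ × ℤ) :
    Commute (L.subtypeL ∘L J ∘L K.orthogonalProjectionOnto) (U z) := by
  ext x
  refine hJ z (K.orthogonalProjectionOnto x) (K.orthogonalProjectionOnto (U z x)) ?_
  exact DFunLike.congr_fun (hU.commute_starProjection hK z).eq x

end IsUnitaryRep

end Sums

/-! ### Multiplicities of a product of two actions -/

section Product

variable {X Y : Type*} [MeasurableSpace X] [MeasurableSpace Y] {μ : Measure X} {ν : Measure Y}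
  [IsProbabilityMeasure μ] [IsProbabilityMeasure ν]

namespace Z2Action

/-- The vectors `h 0`, `h 1` generate isomorphic orthogonal cyclic subspaces whose sum is the
space of functions with zero mean. -/
structure IsGeneratingPair (S : Z2Action μ) (h : Fin 2 → Lp ℂ 2 μ) : Prop where
  mem : ∀ i, h i ∈ L2Zero μ
  ortho : ∀ i j, i ≠ j → ∀ z z', inner ℂ (S.koopman z (h i)) (S.koopman z' (h j)) = 0
  corr : ∀ i j z, inner ℂ (S.koopman z (h i)) (h i) = inner ℂ (S.koopman z (h j)) (h j)
  spans : ∀ f ∈ L2Zero μ, ∃ s : Fin 2 → Lp ℂ 2 μ,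
    (∀ i, s i ∈ cyclicSpan S.koopman (h i)) ∧ f = ∑ i, s i
  ne_zero : h 0 ≠ 0

/-- A vector fixed by `1 ⊗ T^z` is orthogonal to `f ⊗ k` for `k` of zero mean. -/
theorem inner_eq_zero_of_fixed_right {T : Z2Action ν} (hT : T.FixesOnlyConstants) {z : ℤ × ℤ}
    (hz : z ≠ 0) {y : Lp ℂ 2 (μ.prod ν)} (hy : opTensor 1 (T.koopman z) y = y)
    (f : Lp ℂ 2 μ) {k : Lp ℂ 2 ν} (hk : k ∈ L2Zero ν) : inner ℂ y (lpTmul f k) = 0 := by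
  -- `m` is the partial integral of `y` against `f` over the first variable; it inherits invariance
  -- under `T^z` and is therefore constant.
  set m := ContinuousLinearMap.adjoint (lpTmulL f) y with hm
  have hmi : ∀ k, inner ℂ m k = inner ℂ y (lpTmul f k) := fun k =>
    ContinuousLinearMap.adjoint_inner_left _ _ _
  have hfix : T.koopman z m = m := by
    refine ext_inner_right ℂ fun k => ?_
    rw [T.isUnitaryRep_koopman.inner_left, hmi, hmi]
    nth_rw 2 [← hy]
    rw [← ContinuousLinearMap.adjoint_inner_right, ← ContinuousLinearMap.star_eq_adjoint,
      star_opTensor, opTensor_lpTmul, T.isUnitaryRep_koopman.star_eq, star_one]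
    rfl
  rw [← hmi]
  exact Submodule.inner_right_of_mem_orthogonal (hT z hz m hfix) hk

/-- A vector fixed by `S^z ⊗ 1` is orthogonal to `k ⊗ g` for `k` of zero mean. -/
theorem inner_eq_zero_of_fixed_left {S : Z2Action μ} (hS : S.FixesOnlyConstants) {z : ℤ × ℤ}
    (hz : z ≠ 0) {y : Lp ℂ 2 (μ.prod ν)} (hy : opTensor (S.koopman z) 1 y = y)
    {k : Lp ℂ 2 μ} (hk : k ∈ L2Zero μ) (g : Lp ℂ 2 ν) : inner ℂ y (lpTmul k g) = 0 := by
  set m := ContinuousLinearMap.adjoint (lpTmulL.flip g) y with hm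
  have hmi : ∀ k, inner ℂ m k = inner ℂ y (lpTmul k g) := fun k =>
    ContinuousLinearMap.adjoint_inner_left _ _ _
  have hfix : S.koopman z m = m := by
    refine ext_inner_right ℂ fun k => ?_
    rw [S.isUnitaryRep_koopman.inner_left, hmi, hmi]
    nth_rw 2 [← hy]
    rw [← ContinuousLinearMap.adjoint_inner_right, ← ContinuousLinearMap.star_eq_adjoint,
      star_opTensor, opTensor_lpTmul, S.isUnitaryRep_koopman.star_eq, star_one]
    rfl
  rw [← hmi]
  exact Submodule.inner_right_of_mem_orthogonal (hS z hz m hfix) hk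

/-- Every operator commuting with the product action commutes with the action on the second
factor. -/
def CommutantSplits (S : Z2Action μ) (T : Z2Action ν) : Prop :=
  ∀ J : Lp ℂ 2 (μ.prod ν) →L[ℂ] Lp ℂ 2 (μ.prod ν), (∀ z, Commute J ((S.prod T).koopman z)) →
    ∀ z, Commute J (opTensor 1 (T.koopman z))

variable {S : Z2Action μ} {T : Z2Action ν}

/-- `S^z ⊗ 1 = (S^z ⊗ T^z)(1 ⊗ T^{-z})`. -/
theorem CommutantSplits.left (h : CommutantSplits S T)
    {J : Lp ℂ 2 (μ.prod ν) →L[ℂ] Lp ℂ 2 (μ.prod ν)}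
    (hJ : ∀ z, Commute J ((S.prod T).koopman z)) (z : ℤ × ℤ) :
    Commute J (opTensor (S.koopman z) 1) := by
  have h1 := (hJ z).mul_right (h J hJ (-z))
  rwa [koopman_prod, opTensor_mul, mul_one, ← T.isUnitaryRep_koopman.add, add_neg_cancel,
    T.isUnitaryRep_koopman.zero] at h1

/-- A closed invariant subspace of the product action containing `f₀ ⊗ g₀` contains `f ⊗ g` for
`f`, `g` in the respective cyclic subspaces. -/
theorem CommutantSplits.lpTmul_mem (h : CommutantSplits S T) {K : Submodule ℂ (Lp ℂ 2 (μ.prod ν))}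
    (hKc : IsClosed (K : Set (Lp ℂ 2 (μ.prod ν))))
    (hK : ∀ z, ∀ x ∈ K, (S.prod T).koopman z x ∈ K) {f₀ f : Lp ℂ 2 μ} {g₀ g : Lp ℂ 2 ν}
    (h₀ : lpTmul f₀ g₀ ∈ K) (hf : f ∈ cyclicSpan S.koopman f₀)
    (hg : g ∈ cyclicSpan T.koopman g₀) : lpTmul f g ∈ K := by
  have : CompleteSpace K := hKc.completeSpace_coe
  -- The projection onto `K` lies in the commutant, so splitting makes `K` invariant under `S^z ⊗ 1`
  -- and `1 ⊗ T^z` separately.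
  have hcomm := (S.prod T).isUnitaryRep_koopman.commute_starProjection hK
  have mem_of : ∀ {A : Lp ℂ 2 (μ.prod ν) →L[ℂ] Lp ℂ 2 (μ.prod ν)},
      Commute K.starProjection A → ∀ x ∈ K, A x ∈ K := by
    intro A hA x hx
    have h1 := DFunLike.congr_fun hA.eq x
    rw [mul_apply_eq_comp, mul_apply_eq_comp, Submodule.starProjection_eq_self_iff.2 hx] at h1
    exact Submodule.starProjection_eq_self_iff.1 h1
  have step : ∀ z, lpTmul (S.koopman z f₀) g ∈ K := by
    intro z
    have h1 : cyclicSpan T.koopman g₀ ≤ K.comap (lpTmulL (S.koopman z f₀)).toLinearMap := by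
      refine cyclicSpan_le (isClosed_comap hKc _) fun z' => ?_
      have h2 := mem_of (h.left hcomm z) _ (mem_of (h _ hcomm z') _ h₀)
      rw [opTensor_lpTmul, opTensor_lpTmul] at h2
      exact h2
    exact h1 hg
  have h1 : cyclicSpan S.koopman f₀ ≤ K.comap (lpTmulL.flip g).toLinearMap :=
    cyclicSpan_le (isClosed_comap hKc _) fun z => step z
  exact h1 hf

theorem koopman_prod_lpTmul (z : ℤ × ℤ) (f : Lp ℂ 2 μ) (g : Lp ℂ 2 ν) :
    (S.prod T).koopman z (lpTmul f g) = lpTmul (S.koopman z f) (T.koopman z g) := by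
  rw [koopman_prod, opTensor_lpTmul]

theorem lpTmul_left_mem_L2Zero {f : Lp ℂ 2 μ} (hf : f ∈ L2Zero μ) (g : Lp ℂ 2 ν) :
    lpTmul f g ∈ L2Zero (μ.prod ν) := by
  rw [mem_L2Zero_iff, ← lpTmul_lpOne, inner_lpTmul, mem_L2Zero_iff.1 hf, zero_mul]

theorem lpTmul_right_mem_L2Zero (f : Lp ℂ 2 μ) {g : Lp ℂ 2 ν} (hg : g ∈ L2Zero ν) :
    lpTmul f g ∈ L2Zero (μ.prod ν) := by
  rw [mem_L2Zero_iff, ← lpTmul_lpOne, inner_lpTmul, mem_L2Zero_iff.1 hg, mul_zero]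

variable {hA : Fin 2 → Lp ℂ 2 μ} {hB : Fin 2 → Lp ℂ 2 ν}

/-- The generators `a(x) + b(y)` of the part of multiplicity two. -/
def sumGen (hA : Fin 2 → Lp ℂ 2 μ) (hB : Fin 2 → Lp ℂ 2 ν) (i : Fin 2) : Lp ℂ 2 (μ.prod ν) :=
  lpTmul (hA i) (lpOne ν) + lpTmul (lpOne μ) (hB i)

/-- The generators `a(x) b(y)` of the part of multiplicity four. -/
def prodGen (hA : Fin 2 → Lp ℂ 2 μ) (hB : Fin 2 → Lp ℂ 2 ν) (i : Fin 2 × Fin 2) :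
    Lp ℂ 2 (μ.prod ν) :=
  lpTmul (hA i.1) (hB i.2)

theorem koopman_sumGen (z : ℤ × ℤ) (i : Fin 2) :
    (S.prod T).koopman z (sumGen hA hB i) =
      sumGen (fun i => S.koopman z (hA i)) (fun i => T.koopman z (hB i)) i := by
  rw [sumGen, _root_.map_add, koopman_prod_lpTmul, koopman_prod_lpTmul, koopman_const,
    koopman_const, sumGen]

theorem koopman_prodGen (z : ℤ × ℤ) (i : Fin 2 × Fin 2) :
    (S.prod T).koopman z (prodGen hA hB i) =
      lpTmul (S.koopman z (hA i.1)) (T.koopman z (hB i.2)) := koopman_prod_lpTmul _ _ _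

/-- Each cross term contains the mean of `a i` or of `a' j`, so zero mean on the first factor is
enough. -/
theorem inner_sumGen {a a' : Fin 2 → Lp ℂ 2 μ} {b b' : Fin 2 → Lp ℂ 2 ν} {i j : Fin 2}
    (ha : a i ∈ L2Zero μ) (ha' : a' j ∈ L2Zero μ) :
    inner ℂ (sumGen a b i) (sumGen a' b' j) = inner ℂ (a i) (a' j) + inner ℂ (b i) (b' j) := by
  simp only [sumGen, inner_add_left, inner_add_right, inner_lpTmul, inner_lpOne_self,
    mem_L2Zero_iff'.1 ha, mem_L2Zero_iff.1 ha']
  ring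

theorem sumGen_mem_L2Zero {a : Fin 2 → Lp ℂ 2 μ} {b : Fin 2 → Lp ℂ 2 ν} {i : Fin 2}
    (ha : a i ∈ L2Zero μ) (hb : b i ∈ L2Zero ν) : sumGen a b i ∈ L2Zero (μ.prod ν) :=
  Submodule.add_mem _ (lpTmul_left_mem_L2Zero ha _) (lpTmul_right_mem_L2Zero _ hb)

theorem hasHomogeneousSpectrum_sumGen (hS : S.IsGeneratingPair hA) (hT : T.IsGeneratingPair hB) :
    HasHomogeneousSpectrum (S.prod T).koopman
      (cyclicSum (S.prod T).koopman (sumGen hA hB)) (2 : ℕ) := by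
  refine (S.prod T).isUnitaryRep_koopman.hasHomogeneousSpectrum (by norm_num) (Equiv.refl _) ?_ ?_
  · intro i j hij z z'
    rw [koopman_sumGen, koopman_sumGen, inner_sumGen (S.koopman_mem_L2Zero _ (hS.mem i))
      (S.koopman_mem_L2Zero _ (hS.mem j)), hS.ortho i j hij, hT.ortho i j hij, add_zero]
  · intro i j z
    rw [koopman_sumGen, koopman_sumGen, inner_sumGen (S.koopman_mem_L2Zero _ (hS.mem i))
      (hS.mem i), inner_sumGen (S.koopman_mem_L2Zero _ (hS.mem j)) (hS.mem j), hS.corr i j,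
      hT.corr i j]

/-- Correlations of products multiply, so they agree for all four pairs; distinct pairs differ in a
coordinate, where orthogonality applies. -/
theorem hasHomogeneousSpectrum_prodGen (hS : S.IsGeneratingPair hA) (hT : T.IsGeneratingPair hB) :
    HasHomogeneousSpectrum (S.prod T).koopman
      (cyclicSum (S.prod T).koopman (prodGen hA hB)) (4 : ℕ) := by
  refine (S.prod T).isUnitaryRep_koopman.hasHomogeneousSpectrum (by norm_num) finProdFinEquiv ?_ ?_
  · intro i j hij z z'
    rw [koopman_prodGen, koopman_prodGen, inner_lpTmul]
    by_cases h1 : i.1 = j.1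
    · rw [hT.ortho i.2 j.2 (fun h2 => hij (Prod.ext h1 h2)), mul_zero]
    · rw [hS.ortho i.1 j.1 h1, zero_mul]
  · intro i j z
    rw [koopman_prodGen, koopman_prodGen, prodGen, prodGen, inner_lpTmul, inner_lpTmul,
      hS.corr i.1 j.1, hT.corr i.2 j.2]

theorem sumGen_isOrtho_prodGen (hS : S.IsGeneratingPair hA) (hT : T.IsGeneratingPair hB) :
    cyclicSum (S.prod T).koopman (sumGen hA hB) ⟂
      cyclicSum (S.prod T).koopman (prodGen hA hB) := by
  refine cyclicSum_isOrtho fun i j z z' => ?_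
  rw [koopman_sumGen, koopman_prodGen, sumGen, inner_add_left, inner_lpTmul, inner_lpTmul,
    mem_L2Zero_iff.1 (S.koopman_mem_L2Zero _ (hS.mem _)),
    mem_L2Zero_iff.1 (T.koopman_mem_L2Zero _ (hT.mem _)), mul_zero, zero_mul, add_zero]

/-- An operator commuting with the action and with values in the part generated by the products
vanishes on the part generated by the sums. -/
theorem apply_eq_zero_of_commute (hfix : (S.prod T).FixesOnlyConstants)
    (hcomm : CommutantSplits S T) (hS : S.IsGeneratingPair hA) (hT : T.IsGeneratingPair hB)
    {J : Lp ℂ 2 (μ.prod ν) →L[ℂ] Lp ℂ 2 (μ.prod ν)}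
    (hJ : ∀ z, Commute J ((S.prod T).koopman z))
    (hJr : ∀ x, J x ∈ cyclicSum (S.prod T).koopman (prodGen hA hB))
    {x : Lp ℂ 2 (μ.prod ν)} (hx : x ∈ cyclicSum (S.prod T).koopman (sumGen hA hB)) : J x = 0 := by
  have he : ((1, 0) : ℤ × ℤ) ≠ 0 := by simp
  have hzero : ∀ y ∈ cyclicSum (S.prod T).koopman (prodGen hA hB),
      (∀ f ∈ L2Zero μ, ∀ k ∈ L2Zero ν, inner ℂ y (lpTmul f k) = 0) → y = 0 := by
    intro y hy h
    have h1 : cyclicSum (S.prod T).koopman (prodGen hA hB) ≤ (Submodule.span ℂ {y})ᗮ := by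
      refine cyclicSum_le (Submodule.isClosed_orthogonal _) fun i z => ?_
      rw [Submodule.mem_orthogonal_singleton_iff_inner_right, koopman_prodGen]
      exact h _ (S.koopman_mem_L2Zero _ (hS.mem _)) _ (T.koopman_mem_L2Zero _ (hT.mem _))
    exact inner_self_eq_zero.1 (Submodule.mem_orthogonal_singleton_iff_inner_right.1 (h1 hy))
  -- `f ⊗ 1` is fixed by `1 ⊗ T^(1,0)`, hence so is its image, while the product part contains no
  -- nonzero such vector.
  have hleft : ∀ f, J (lpTmul f (lpOne ν)) = 0 := by
    intro f
    refine hzero _ (hJr _) fun f' _ k hk =>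
      inner_eq_zero_of_fixed_right hfix.snd he ?_ f' hk
    have := DFunLike.congr_fun (hcomm J hJ (1, 0)).eq (lpTmul f (lpOne ν))
    rw [mul_apply_eq_comp, mul_apply_eq_comp, opTensor_lpTmul, koopman_const] at this
    exact this.symm
  have hright : ∀ g, J (lpTmul (lpOne μ) g) = 0 := by
    intro g
    refine hzero _ (hJr _) fun k hk g' _ =>
      inner_eq_zero_of_fixed_left hfix.fst he ?_ hk g'
    have := DFunLike.congr_fun (hcomm.left hJ (1, 0)).eq (lpTmul (lpOne μ) g)
    rw [mul_apply_eq_comp, mul_apply_eq_comp, opTensor_lpTmul, koopman_const] at this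
    exact this.symm
  have h1 : cyclicSum (S.prod T).koopman (sumGen hA hB) ≤
      (⊥ : Submodule ℂ (Lp ℂ 2 (μ.prod ν))).comap J.toLinearMap := by
    refine cyclicSum_le (isClosed_comap isClosed_singleton J) fun i z => ?_
    rw [koopman_sumGen, Submodule.mem_comap, Submodule.mem_bot]
    change J (sumGen _ _ _) = 0
    rw [sumGen, _root_.map_add, hleft, hright, add_zero]
  exact h1 hx

theorem restrictionsDisjoint_sum_prod (hfix : (S.prod T).FixesOnlyConstants)
    (hcomm : CommutantSplits S T) (hS : S.IsGeneratingPair hA) (hT : T.IsGeneratingPair hB) :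
    RestrictionsDisjoint (S.prod T).koopman (cyclicSum (S.prod T).koopman (sumGen hA hB))
      (cyclicSum (S.prod T).koopman (prodGen hA hB)) := by
  intro J hJ
  have hU := (S.prod T).isUnitaryRep_koopman
  have : CompleteSpace (cyclicSum (S.prod T).koopman (sumGen hA hB)) :=
    (isClosed_cyclicSum _).completeSpace_coe
  ext1 x
  have h1 := apply_eq_zero_of_commute hfix hcomm hS hT
    (hU.commute_extension (fun z x hx => hU.map_mem_cyclicSum z hx) hJ) (fun x => Subtype.prop _)
    x.2
  refine Subtype.ext (Eq.trans ?_ h1)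
  change _ = ((J (Submodule.orthogonalProjectionOnto _ (x : Lp ℂ 2 (μ.prod ν)))) : Lp ℂ 2 (μ.prod ν))
  rw [Submodule.orthogonalProjectionOnto_mem_subspace_eq_self]

/-- The adjoint of the extension by zero runs from the sum part to the product part, so it vanishes
on the range of `A`; then `A* A = 0` and `A = 0`. -/
theorem restrictionsDisjoint_prod_sum (hfix : (S.prod T).FixesOnlyConstants)
    (hcomm : CommutantSplits S T) (hS : S.IsGeneratingPair hA) (hT : T.IsGeneratingPair hB) :
    RestrictionsDisjoint (S.prod T).koopman (cyclicSum (S.prod T).koopman (prodGen hA hB))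
      (cyclicSum (S.prod T).koopman (sumGen hA hB)) := by
  have hU := (S.prod T).isUnitaryRep_koopman
  set K := cyclicSum (S.prod T).koopman (prodGen hA hB) with hK
  set L := cyclicSum (S.prod T).koopman (sumGen hA hB) with hL
  intro J hJ
  have : CompleteSpace K := (isClosed_cyclicSum _).completeSpace_coe
  set A : Lp ℂ 2 (μ.prod ν) →L[ℂ] Lp ℂ 2 (μ.prod ν) :=
    L.subtypeL ∘L J ∘L K.orthogonalProjectionOnto with hA'
  have hAc : ∀ z, Commute A ((S.prod T).koopman z) :=
    hU.commute_extension (fun z x hx => hU.map_mem_cyclicSum z hx) hJ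
  have hrange : ∀ y, star A y ∈ K := by
    intro y
    rw [← K.orthogonal_orthogonal, Submodule.mem_orthogonal]
    intro w hw
    rw [ContinuousLinearMap.star_eq_adjoint, ContinuousLinearMap.adjoint_inner_right]
    have : A w = 0 := by
      have h1 : K.orthogonalProjectionOnto w = 0 :=
        Subtype.ext ((Submodule.starProjection_apply_eq_zero_iff K).2 hw)
      change ((J (K.orthogonalProjectionOnto w) : L) : Lp ℂ 2 (μ.prod ν)) = 0
      rw [h1, _root_.map_zero]
      rfl
    rw [this, inner_zero_left]
  have hA0 : ∀ x, A x = 0 := by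
    intro x
    have h1 : star A (A x) = 0 := apply_eq_zero_of_commute hfix hcomm hS hT
      (hU.commute_star hAc) hrange (Subtype.prop _)
    rw [← inner_self_eq_zero (𝕜 := ℂ), ← ContinuousLinearMap.adjoint_inner_left,
      ← ContinuousLinearMap.star_eq_adjoint, h1, inner_zero_left]
  ext1 x
  refine Subtype.ext (Eq.trans ?_ (hA0 x))
  change _ = ((J (Submodule.orthogonalProjectionOnto _ (x : Lp ℂ 2 (μ.prod ν)))) : Lp ℂ 2 (μ.prod ν))
  rw [Submodule.orthogonalProjectionOnto_mem_subspace_eq_self]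

/-- The cyclic subspace generated by `a(x) + b(y)` contains `a(x)` and `b(y)`. -/
theorem summands_mem_cyclicSpan (hfix : (S.prod T).FixesOnlyConstants)
    (hcomm : CommutantSplits S T) {a : Lp ℂ 2 μ} {b : Lp ℂ 2 ν} (ha : a ∈ L2Zero μ)
    (hb : b ∈ L2Zero ν) :
    lpTmul a (lpOne ν) ∈
        cyclicSpan (S.prod T).koopman (lpTmul a (lpOne ν) + lpTmul (lpOne μ) b) ∧
      lpTmul (lpOne μ) b ∈
        cyclicSpan (S.prod T).koopman (lpTmul a (lpOne ν) + lpTmul (lpOne μ) b) := by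
  have hU := (S.prod T).isUnitaryRep_koopman
  set g := lpTmul a (lpOne ν) + lpTmul (lpOne μ) b with hg
  set K := cyclicSpan (S.prod T).koopman g with hK
  have : CompleteSpace K := (isClosed_cyclicSpan _).completeSpace_coe
  have hgK : g ∈ K := hU.self_mem_cyclicSpan g
  have hga : g ∈ L2Zero (μ.prod ν) :=
    Submodule.add_mem _ (lpTmul_left_mem_L2Zero ha _) (lpTmul_right_mem_L2Zero _ hb)
  have hK0 : K ≤ L2Zero (μ.prod ν) :=
    cyclicSpan_le (Submodule.isClosed_orthogonal _) fun z => koopman_mem_L2Zero _ z hga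
  set p := K.starProjection with hp
  have hpc : ∀ z, Commute p ((S.prod T).koopman z) :=
    hU.commute_starProjection fun z x hx => hU.map_mem_cyclicSpan z hx
  -- Since `p` fixes the sum `g`, the defect `d` of `a ⊗ 1` is minus that of `1 ⊗ b`. The first form
  -- shows invariance under `1 ⊗ T^e`, the second under `S^e ⊗ 1`; a zero mean vector with both is
  -- zero.
  set d := p (lpTmul a (lpOne ν)) - lpTmul a (lpOne ν) with hd
  have hd' : d = lpTmul (lpOne μ) b - p (lpTmul (lpOne μ) b) := by
    have h1 : p g = g := Submodule.starProjection_eq_self_iff.2 hgK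
    rw [hg, _root_.map_add] at h1
    rw [hd, sub_eq_sub_iff_add_eq_add, h1, add_comm]
  have he : ((1, 0) : ℤ × ℤ) ≠ 0 := by simp
  have hfix1 : opTensor 1 (T.koopman (1, 0)) d = d := by
    have h1 := DFunLike.congr_fun (hcomm p hpc (1, 0)).eq (lpTmul a (lpOne ν))
    rw [mul_apply_eq_comp, mul_apply_eq_comp, opTensor_lpTmul, koopman_const] at h1
    rw [hd, map_sub, opTensor_lpTmul, koopman_const, ← h1]
    rfl
  have hfix2 : opTensor (S.koopman (1, 0)) 1 d = d := by
    have h1 := DFunLike.congr_fun (hcomm.left hpc (1, 0)).eq (lpTmul (lpOne μ) b)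
    rw [mul_apply_eq_comp, mul_apply_eq_comp, opTensor_lpTmul, koopman_const] at h1
    rw [hd', map_sub, opTensor_lpTmul, koopman_const, ← h1]
    rfl
  have hd0 : d = 0 := by
    refine hfix.eq_zero he ?_ (Submodule.sub_mem _ (hK0 (Submodule.starProjection_apply_mem _ _))
      (lpTmul_left_mem_L2Zero ha _))
    have : (S.prod T).koopman (1, 0) =
        opTensor (S.koopman (1, 0)) 1 * opTensor 1 (T.koopman (1, 0)) := by
      rw [koopman_prod, opTensor_mul, mul_one, one_mul]
    rw [this, mul_apply_eq_comp, hfix1, hfix2]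
  have h1 : lpTmul a (lpOne ν) ∈ K := Submodule.starProjection_eq_self_iff.1 (sub_eq_zero.1 hd0)
  refine ⟨h1, ?_⟩
  have h2 := Submodule.sub_mem _ hgK h1
  rwa [hg, add_sub_cancel_left] at h2

/-- Splitting off means writes `f ⊗ g` as a constant plus terms in `L²₀ ⊗ 1`, `1 ⊗ L²₀` and `L²₀ ⊗
L²₀`. The sum generators reach the first two spaces, the product generators the third. -/
theorem cyclicSum_sup_eq_L2Zero (hfix : (S.prod T).FixesOnlyConstants)
    (hcomm : CommutantSplits S T) (hS : S.IsGeneratingPair hA) (hT : T.IsGeneratingPair hB) :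
    (cyclicSum (S.prod T).koopman (sumGen hA hB) ⊔
      cyclicSum (S.prod T).koopman (prodGen hA hB)).topologicalClosure = L2Zero (μ.prod ν) := by
  have hU := (S.prod T).isUnitaryRep_koopman
  have hone₁ : lpOne μ ∈ cyclicSpan S.koopman (lpOne μ) :=
    S.isUnitaryRep_koopman.self_mem_cyclicSpan _
  have hone₂ : lpOne ν ∈ cyclicSpan T.koopman (lpOne ν) :=
    T.isUnitaryRep_koopman.self_mem_cyclicSpan _
  set K := (cyclicSum (S.prod T).koopman (sumGen hA hB) ⊔
    cyclicSum (S.prod T).koopman (prodGen hA hB)) with hK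
  have hKle : K.topologicalClosure ≤ L2Zero (μ.prod ν) := by
    refine Submodule.topologicalClosure_minimal _ (sup_le ?_ ?_) (Submodule.isClosed_orthogonal _)
    · refine cyclicSum_le (Submodule.isClosed_orthogonal _) fun i z => ?_
      exact koopman_mem_L2Zero _ _ (sumGen_mem_L2Zero (hS.mem i) (hT.mem i))
    · refine cyclicSum_le (Submodule.isClosed_orthogonal _) fun i z => ?_
      exact koopman_mem_L2Zero _ _ (lpTmul_left_mem_L2Zero (hS.mem i.1) _)
  refine le_antisymm hKle ?_
  · have : CompleteSpace K.topologicalClosure :=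
      (Submodule.isClosed_topologicalClosure _).completeSpace_coe
    have hsum : ∀ i, cyclicSpan (S.prod T).koopman (sumGen hA hB i) ≤ K := fun i =>
      (cyclicSpan_le_cyclicSum _ i).trans le_sup_left
    have hprod : ∀ i, cyclicSpan (S.prod T).koopman (prodGen hA hB i) ≤ K := fun i =>
      (cyclicSpan_le_cyclicSum _ i).trans le_sup_right
    have hl : ∀ f ∈ L2Zero μ, lpTmul f (lpOne ν) ∈ K := by
      intro f hf
      obtain ⟨s, hs, rfl⟩ := hS.spans f hf
      rw [map_sum, LinearMap.sum_apply]
      refine Submodule.sum_mem _ fun i _ => hsum i ?_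
      have h₀ : lpTmul (hA i) (lpOne ν) ∈ cyclicSpan (S.prod T).koopman (sumGen hA hB i) :=
        (summands_mem_cyclicSpan hfix hcomm (hS.mem i) (hT.mem i)).1
      exact hcomm.lpTmul_mem (isClosed_cyclicSpan _) (fun z x hx => hU.map_mem_cyclicSpan z hx)
        h₀ (hs i) hone₂
    have hr : ∀ g ∈ L2Zero ν, lpTmul (lpOne μ) g ∈ K := by
      intro g hg
      obtain ⟨s, hs, rfl⟩ := hT.spans g hg
      rw [map_sum]
      refine Submodule.sum_mem _ fun i _ => hsum i ?_
      have h₀ : lpTmul (lpOne μ) (hB i) ∈ cyclicSpan (S.prod T).koopman (sumGen hA hB i) :=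
        (summands_mem_cyclicSpan hfix hcomm (hS.mem i) (hT.mem i)).2
      exact hcomm.lpTmul_mem (isClosed_cyclicSpan _) (fun z x hx => hU.map_mem_cyclicSpan z hx)
        h₀ hone₁ (hs i)
    have hlr : ∀ f ∈ L2Zero μ, ∀ g ∈ L2Zero ν, lpTmul f g ∈ K := by
      intro f hf g hg
      obtain ⟨s, hs, rfl⟩ := hS.spans f hf
      obtain ⟨t, ht, rfl⟩ := hT.spans g hg
      rw [map_sum]
      refine Submodule.sum_mem _ fun j _ => ?_
      rw [map_sum, LinearMap.sum_apply]
      refine Submodule.sum_mem _ fun i _ => hprod (i, j) ?_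
      have h₀ : lpTmul (hA i) (hB j) ∈ cyclicSpan (S.prod T).koopman (prodGen hA hB (i, j)) :=
        hU.self_mem_cyclicSpan (prodGen hA hB (i, j))
      exact hcomm.lpTmul_mem (isClosed_cyclicSpan _) (fun z x hx => hU.map_mem_cyclicSpan z hx)
        h₀ (hs i) (ht j)
    intro y hy
    set w := y - K.topologicalClosure.starProjection y with hw
    have hwo : w ∈ K.topologicalClosureᗮ := Submodule.sub_starProjection_mem_orthogonal _
    rw [Submodule.orthogonal_closure, Submodule.mem_orthogonal] at hwo
    have hw0 : inner ℂ (lpOne (μ.prod ν)) w = 0 :=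
      mem_L2Zero_iff.1 (Submodule.sub_mem _ hy (hKle (Submodule.starProjection_apply_mem _ _)))
    have hwz : w = 0 := by
      refine eq_zero_of_inner_lpTmul fun f g => ?_
      set f₀ := f - inner ℂ (lpOne μ) f • lpOne μ with hf₀
      set g₀ := g - inner ℂ (lpOne ν) g • lpOne ν with hg₀
      have hfz : f₀ ∈ L2Zero μ := sub_inner_smul_mem_L2Zero f
      have hgz : g₀ ∈ L2Zero ν := sub_inner_smul_mem_L2Zero g
      have hf : f = f₀ + inner ℂ (lpOne μ) f • lpOne μ := (sub_add_cancel _ _).symm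
      have hg : g = g₀ + inner ℂ (lpOne ν) g • lpOne ν := (sub_add_cancel _ _).symm
      rw [hf, hg]
      simp only [_root_.map_add, map_smul, LinearMap.add_apply, LinearMap.smul_apply,
        inner_add_left, inner_smul_left, hwo _ (hlr _ hfz _ hgz), hwo _ (hl _ hfz),
        hwo _ (hr _ hgz), lpTmul_lpOne, hw0, mul_zero, add_zero]
    rw [sub_eq_zero.1 hwz]
    exact Submodule.starProjection_apply_mem _ _

/-- The product of two actions with twofold homogeneous spectrum has multiplicities two and four,
provided the commutant splits. -/
theorem hasSpectralMultiplicities_prod (hfix : (S.prod T).FixesOnlyConstants)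
    (hcomm : CommutantSplits S T) (hS : S.IsGeneratingPair hA) (hT : T.IsGeneratingPair hB) :
    (S.prod T).HasSpectralMultiplicities {2, 4} := by
  classical
  have hU := (S.prod T).isUnitaryRep_koopman
  set P₂ := cyclicSum (S.prod T).koopman (sumGen hA hB) with hP₂
  set P₄ := cyclicSum (S.prod T).koopman (prodGen hA hB) with hP₄
  have h24 : (4 : ℕ∞) ≠ 2 := by decide
  have hne₂ : P₂ ≠ ⊥ := by
    intro h
    have h1 : sumGen hA hB 0 ∈ P₂ :=
      cyclicSpan_le_cyclicSum _ 0 (hU.self_mem_cyclicSpan _)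
    rw [h, Submodule.mem_bot] at h1
    have h2 : inner ℂ (lpTmul (hA 0) (lpOne ν)) (sumGen hA hB 0) = 0 := by
      rw [h1, inner_zero_right]
    rw [sumGen, inner_add_right, inner_lpTmul, inner_lpTmul, inner_lpOne_self,
      mem_L2Zero_iff'.1 (hS.mem 0), zero_mul, add_zero, mul_one] at h2
    exact hS.ne_zero (inner_self_eq_zero.1 h2)
  have hne₄ : P₄ ≠ ⊥ := by
    intro h
    have h1 : prodGen hA hB (0, 0) ∈ P₄ :=
      cyclicSpan_le_cyclicSum _ (0, 0) (hU.self_mem_cyclicSpan _)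
    rw [h, Submodule.mem_bot] at h1
    have h2 := norm_lpTmul (hA 0) (hB 0)
    rw [show lpTmul (hA 0) (hB 0) = 0 from h1, norm_zero] at h2
    rcases mul_eq_zero.1 h2.symm with h3 | h3
    · exact hS.ne_zero (norm_eq_zero.1 h3)
    · exact hT.ne_zero (norm_eq_zero.1 h3)
  have ho := sumGen_isOrtho_prodGen (S := S) (T := T) hS hT
  refine ⟨fun n => if (n : ℕ∞) = 2 then P₂ else P₄, ?_, ?_, ?_, ?_, ?_⟩
  · rintro ⟨n, rfl | rfl⟩
    · simpa using hne₂
    · simpa [h24] using hne₄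
  · rintro ⟨n, rfl | rfl⟩
    · simpa using hasHomogeneousSpectrum_sumGen hS hT
    · simpa [h24] using hasHomogeneousSpectrum_prodGen hS hT
  · rintro ⟨m, rfl | rfl⟩ ⟨n, rfl | rfl⟩ hmn
    · exact (hmn rfl).elim
    · simpa [h24] using ho
    · simpa [h24] using ho.symm
    · exact (hmn rfl).elim
  · rintro ⟨m, rfl | rfl⟩ ⟨n, rfl | rfl⟩ hmn
    · exact (hmn rfl).elim
    · simpa [h24] using restrictionsDisjoint_sum_prod hfix hcomm hS hT
    · simpa [h24] using restrictionsDisjoint_prod_sum hfix hcomm hS hT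
    · exact (hmn rfl).elim
  · rw [← cyclicSum_sup_eq_L2Zero hfix hcomm hS hT]
    congr 1
    refine le_antisymm (iSup_le ?_) (sup_le ?_ ?_)
    · rintro ⟨n, rfl | rfl⟩
      · exact (if_pos rfl).le.trans le_sup_left
      · exact (if_neg h24).le.trans le_sup_right
    · refine le_trans (le_of_eq ?_) (le_iSup _ (⟨2, by simp⟩ : ({2, 4} : Set ℕ∞)))
      simp [hP₂]
    · refine le_trans (le_of_eq ?_) (le_iSup _ (⟨4, by simp⟩ : ({2, 4} : Set ℕ∞)))
      simp [hP₄]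

end Z2Action

end Product

/-! ### Splitting of the commutant -/

section Splitting

variable {X Y : Type*} [MeasurableSpace X] [MeasurableSpace Y] {μ : Measure X} {ν : Measure Y}
  [IsProbabilityMeasure μ] [IsProbabilityMeasure ν]

variable (μ) in
/-- The operator `a I + (1 - a) Θ`. -/
def shrink (a : ℝ) : Lp ℂ 2 μ →L[ℂ] Lp ℂ 2 μ :=
  (a : ℂ) • ContinuousLinearMap.id ℂ (Lp ℂ 2 μ) + (1 - a : ℂ) • constProj μ

theorem constProj_mul_self : constProj μ * constProj μ = constProj μ :=
  (Submodule.isIdempotentElem_starProjection (constSubspace μ)).eq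

/-- Since `Θ` is idempotent, `a ↦ shrink μ a` is multiplicative. For `a > 0` this supplies the
inverse (at `a⁻¹`) and a square root (at `√a`), with no need for `a ≤ 1`. -/
theorem shrink_mul (a b : ℝ) : shrink μ a * shrink μ b = shrink μ (a * b) := by
  change ((a : ℂ) • (1 : Lp ℂ 2 μ →L[ℂ] Lp ℂ 2 μ) + (1 - a : ℂ) • constProj μ) *
    ((b : ℂ) • (1 : Lp ℂ 2 μ →L[ℂ] Lp ℂ 2 μ) + (1 - b : ℂ) • constProj μ) =
    ((a * b : ℝ) : ℂ) • (1 : Lp ℂ 2 μ →L[ℂ] Lp ℂ 2 μ) + (1 - (a * b : ℝ) : ℂ) • constProj μ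
  simp only [add_mul, mul_add, smul_mul_assoc, mul_smul_comm, one_mul, mul_one,
    constProj_mul_self, smul_add, smul_smul, Complex.ofReal_mul]
  module

theorem shrink_one : shrink μ 1 = 1 := by
  simp [shrink]
  rfl

theorem star_shrink (a : ℝ) : star (shrink μ a) = shrink μ a := by
  have h1 : star (constProj μ) = constProj μ :=
    (isSelfAdjoint_starProjection (constSubspace μ)).star_eq
  change star ((a : ℂ) • (1 : Lp ℂ 2 μ →L[ℂ] Lp ℂ 2 μ) + (1 - a : ℂ) • constProj μ) = _
  simp only [star_add, star_smul, star_one, h1, star_sub, RCLike.star_def, Complex.conj_ofReal]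
  rfl

namespace Z2Action

/-- Because `Ŝ^z Θ = Θ`, the weak limit along the sequence takes the form unitary times `shrink`. -/
theorem koopman_mul_shrink (S : Z2Action μ) (z : ℤ × ℤ) (b : ℝ) :
    S.koopman z * shrink μ b = (b : ℂ) • S.koopman z + (1 - b : ℂ) • constProj μ := by
  ext1 f
  simp only [mul_apply_eq_comp, shrink, add_apply, smul_apply, _root_.map_add, map_smul,
    constProj_apply, koopman_const, ContinuousLinearMap.id_apply]

/-- An operator commuting with `R × R × T × T` commutes with `1 × 1 × T^e × T^e`, as soon as
`R^{w_i} → a I + (1 - a) Θ` and `T^{w_i} → b T^e + (1 - b) Θ`. -/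
theorem commute_of_weak_limits {R : Z2Action μ} {T : Z2Action ν} {w : ℕ → ℤ × ℤ} {e : ℤ × ℤ}
    {a b : ℝ} (ha : 0 < a) (hb : 0 < b)
    (hR : WeakOperatorTendsto (fun i => R.koopman (w i)) (shrink μ a))
    (hT : WeakOperatorTendsto (fun i => T.koopman (w i))
      ((b : ℂ) • T.koopman e + (1 - b : ℂ) • constProj ν))
    {J : Lp ℂ 2 ((μ.prod μ).prod (ν.prod ν)) →L[ℂ] Lp ℂ 2 ((μ.prod μ).prod (ν.prod ν))}
    (hJ : ∀ z, Commute J (((R.prod R).prod (T.prod T)).koopman z)) :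
    Commute J (opTensor 1 ((T.prod T).koopman e)) := by
  have hU := ((R.prod R).prod (T.prod T)).isUnitaryRep_koopman
  have hTT := (T.prod T).isUnitaryRep_koopman
  rw [← koopman_mul_shrink] at hT
  let N : ℝ → ℝ → Lp ℂ 2 ((μ.prod μ).prod (ν.prod ν)) →L[ℂ] Lp ℂ 2 ((μ.prod μ).prod (ν.prod ν)) :=
    fun a b => opTensor (opTensor (shrink μ a) (shrink μ a)) (opTensor (shrink ν b) (shrink ν b))
  have hNmul : ∀ a b a' b', N a b * N a' b' = N (a * a') (b * b') := fun a b a' b' => by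
    simp only [N, opTensor_mul, shrink_mul]
  have hN1 : N 1 1 = 1 := by simp only [N, shrink_one, opTensor_one]
  have hNstar : ∀ a b, star (N a b) = N a b := fun a b => by
    simp only [N, star_opTensor, star_shrink]
  -- Tensoring the four limits and pulling out the unitary factor puts the limit in polar form, with
  -- `N a b` as its positive part.
  have hlim : WeakOperatorTendsto (fun i => ((R.prod R).prod (T.prod T)).koopman (w i))
      (opTensor 1 ((T.prod T).koopman e) * N a b) := by
    have h1 := (hR.opTensor hR (fun i => R.norm_koopman_le _) (fun i => R.norm_koopman_le _))
    have h2 := (hT.opTensor hT (fun i => T.norm_koopman_le _) (fun i => T.norm_koopman_le _))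
    simp only [← koopman_prod] at h1 h2
    have h3 := h1.opTensor h2 (fun i => norm_koopman_le _ _) (fun i => norm_koopman_le _ _)
    simp only [← koopman_prod] at h3
    convert h3 using 1
    simp only [N, koopman_prod, opTensor_mul, one_mul]
  have hc1 := hlim.commute fun i => hJ (w i)
  -- `J*` also commutes with the action, so it commutes with the limit; taking adjoints, `J`
  -- commutes with the adjoint of the limit.
  have hc2 := (hlim.commute fun i => hU.commute_star hJ (w i)).star_star
  rw [star_star] at hc2
  refine Commute.of_polar (N := N a b) (N' := N a⁻¹ b⁻¹) (M := N (√a) (√b)) (hNstar _ _) ?_ ?_ ?_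
    hc1 hc2
  · rw [hNmul, Real.mul_self_sqrt ha.le, Real.mul_self_sqrt hb.le]
  · rw [hNmul, mul_inv_cancel₀ ha.ne', mul_inv_cancel₀ hb.ne', hN1]
  · rw [star_opTensor, opTensor_mul, hTT.star_eq, ← hTT.add, neg_add_cancel, hTT.zero, star_one,
      one_mul, opTensor_one]

/-- Commutation with the operators of a representation on the second factor may be checked on the
standard generators of `ℤ × ℤ`. -/
theorem commute_opTensor_of_generators {T : Z2Action ν}
    {J : Lp ℂ 2 (μ.prod ν) →L[ℂ] Lp ℂ 2 (μ.prod ν)}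
    (h₁ : Commute J (opTensor 1 (T.koopman (1, 0)))) (h₂ : Commute J (opTensor 1 (T.koopman (0, 1))))
    (z : ℤ × ℤ) : Commute J (opTensor 1 (T.koopman z)) := by
  have hT := T.isUnitaryRep_koopman
  have hadd : ∀ z z', opTensor (1 : Lp ℂ 2 μ →L[ℂ] Lp ℂ 2 μ) (T.koopman (z + z')) =
      opTensor 1 (T.koopman z) * opTensor 1 (T.koopman z') := fun z z' => by
    rw [opTensor_mul, one_mul, hT.add]
  have hzero : opTensor (1 : Lp ℂ 2 μ →L[ℂ] Lp ℂ 2 μ) (T.koopman 0) = 1 := by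
    rw [hT.zero, opTensor_one]
  let G : AddSubgroup (ℤ × ℤ) :=
    { carrier := {z | Commute J (opTensor 1 (T.koopman z))}
      zero_mem' := by
        change Commute J (opTensor 1 (T.koopman 0))
        rw [hzero]
        exact Commute.one_right J
      add_mem' := fun {z z'} hz hz' => by
        change Commute J (opTensor 1 (T.koopman (z + z')))
        rw [hadd]
        exact Commute.mul_right hz hz'
      neg_mem' := fun {z} hz => by
        change J * opTensor 1 (T.koopman (-z)) = opTensor 1 (T.koopman (-z)) * J
        have h1 : J * opTensor 1 (T.koopman z) = opTensor 1 (T.koopman z) * J := hz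
        have e1 : opTensor (1 : Lp ℂ 2 μ →L[ℂ] Lp ℂ 2 μ) (T.koopman (-z)) *
            opTensor 1 (T.koopman z) = 1 := by rw [← hadd, neg_add_cancel, hzero]
        have e2 : opTensor (1 : Lp ℂ 2 μ →L[ℂ] Lp ℂ 2 μ) (T.koopman z) *
            opTensor 1 (T.koopman (-z)) = 1 := by rw [← hadd, add_neg_cancel, hzero]
        calc J * opTensor 1 (T.koopman (-z))
            = opTensor 1 (T.koopman (-z)) * (opTensor 1 (T.koopman z) * J) *
                opTensor 1 (T.koopman (-z)) := by rw [← mul_assoc, e1, one_mul]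
          _ = opTensor 1 (T.koopman (-z)) * J := by
                rw [← h1, mul_assoc, mul_assoc, e2, mul_one] }
  have hz : z = z.1 • ((1, 0) : ℤ × ℤ) + z.2 • ((0, 1) : ℤ × ℤ) := by ext <;> simp
  have : z ∈ G := by
    rw [hz]
    exact G.add_mem (G.zsmul_mem h₁ _) (G.zsmul_mem h₂ _)
  exact this

/-- On a non-atomic standard Borel probability space there are non-constant functions. -/
theorem exists_ne_zero_mem_L2Zero (μ : Measure X) [IsProbabilityMeasure μ] [StandardBorelSpace X]
    [NullSingletonClass μ] : ∃ f ∈ L2Zero μ, f ≠ 0 := by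
  by_contra! hcon
  -- `arctan` makes the Borel embedding into `ℝ` bounded, hence square integrable. Injectivity turns
  -- level sets into points, which are null, so `φ` is not almost everywhere constant.
  let φ : X → ℂ := fun x => (Real.arctan (embeddingReal X x) : ℂ)
  have hφm : Measurable φ := Complex.measurable_ofReal.comp
    (Real.measurable_arctan.comp (measurable_embeddingReal X))
  have hφb : ∀ x, ‖φ x‖ ≤ Real.pi / 2 := fun x => by
    rw [Complex.norm_real, Real.norm_eq_abs]
    exact (abs_lt.2 ⟨Real.neg_pi_div_two_lt_arctan _, Real.arctan_lt_pi_div_two _⟩).le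
  have hφL : MemLp φ 2 μ := MemLp.of_bound hφm.aestronglyMeasurable _ (.of_forall hφb)
  have hφi : Function.Injective φ := fun x y hxy =>
    (measurableEmbedding_embeddingReal X).injective
      (Real.arctan_injective (Complex.ofReal_injective hxy))
  have h1 := hcon _ (sub_inner_smul_mem_L2Zero (hφL.toLp φ))
  rw [sub_eq_zero] at h1
  set c := inner ℂ (lpOne μ) (hφL.toLp φ)
  have h2 : ∀ᵐ x ∂μ, φ x = c := by
    filter_upwards [hφL.coeFn_toLp, Lp.coeFn_smul c (lpOne μ),
      Lp.coeFn_const 2 μ (1 : ℂ)] with x h3 h4 h5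
    rw [← h3, h1, h4, Pi.smul_apply, h5]
    simp
  have h3 : μ (φ ⁻¹' {c}) = 0 :=
    ((Set.subsingleton_singleton).preimage hφi).measure_zero μ
  have h4 : ∀ᵐ x ∂μ, x ∉ φ ⁻¹' {c} := measure_eq_zero_iff_ae_notMem.1 h3
  obtain ⟨x, hx, hx'⟩ := (h2.and h4).exists
  exact hx' hx

/-- If the symmetric square of a weakly mixing action has simple spectrum, then its Cartesian
square has homogeneous spectrum of multiplicity two. -/
theorem SymmSquareHasSimpleSpectrum.exists_isGeneratingPair [StandardBorelSpace X]
    [NullSingletonClass μ] {R : Z2Action μ} (hsimple : R.SymmSquareHasSimpleSpectrum)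
    (hR : (R.prod R).FixesOnlyConstants) : ∃ h, (R.prod R).IsGeneratingPair h := by
  have hU := (R.prod R).isUnitaryRep_koopman
  obtain ⟨h, h0, h1, hcorr⟩ := hsimple.exists_generators hR
  have hm0 : ∀ z, (R.prod R).koopman z (h 0) ∈ symmSubspace μ ⊓ L2Zero (μ.prod μ) := fun z =>
    h0.le (mem_cyclicSpan_orbit z _)
  have hm1 : ∀ z, (R.prod R).koopman z (h 1) ∈ antiSubspace μ := fun z =>
    h1.le (mem_cyclicSpan_orbit z _)
  have hort : ∀ z z', inner ℂ ((R.prod R).koopman z (h 0)) ((R.prod R).koopman z' (h 1)) = 0 :=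
    fun z z' => inner_symm_anti (mem_symmSubspace.1 (hm0 z).1) (mem_antiSubspace.1 (hm1 z'))
  refine ⟨h, ?_, ?_, ?_, ?_, ?_⟩
  · refine Fin.forall_fin_two.2 ⟨?_, ?_⟩
    · exact (h0.le (hU.self_mem_cyclicSpan _)).2
    · exact antiSubspace_le_L2Zero (h1.le (hU.self_mem_cyclicSpan _))
  · refine Fin.forall_fin_two.2 ⟨Fin.forall_fin_two.2 ⟨fun h => (h rfl).elim, fun _ => hort⟩,
      Fin.forall_fin_two.2 ⟨fun _ z z' => ?_, fun h => (h rfl).elim⟩⟩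
    rw [← inner_conj_symm, hort, _root_.map_zero]
  · exact Fin.forall_fin_two.2 ⟨Fin.forall_fin_two.2 ⟨fun _ => rfl, fun z => (hcorr z).symm⟩,
      Fin.forall_fin_two.2 ⟨hcorr, fun _ => rfl⟩⟩
  · intro f hf
    obtain ⟨s, hs, a, ha, rfl⟩ := exists_symm_add_anti hf
    refine ⟨![s, a], Fin.forall_fin_two.2 ⟨h0.ge hs, h1.ge ha⟩, ?_⟩
    simp
  · intro hzero
    obtain ⟨f, hf, hf0⟩ := exists_ne_zero_mem_L2Zero μ
    -- A nonzero symmetric function of zero mean, which the generator `h 0` must reach.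
    have hmem : lpTmul f (lpOne μ) + lpTmul (lpOne μ) f ∈ symmSubspace μ ⊓ L2Zero (μ.prod μ) := by
      refine ⟨?_, Submodule.add_mem _ (lpTmul_left_mem_L2Zero hf _)
        (lpTmul_right_mem_L2Zero _ hf)⟩
      rw [SetLike.mem_coe, mem_symmSubspace, _root_.map_add, swapOp_lpTmul, swapOp_lpTmul, add_comm]
    have hbot : cyclicSpan (R.prod R).koopman (h 0) ≤ ⊥ :=
      cyclicSpan_le isClosed_singleton fun z => by rw [hzero, _root_.map_zero]; exact zero_mem _
    have h2 := (Submodule.mem_bot ℂ).1 (hbot (h0.ge hmem))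
    have h3 : inner ℂ (lpTmul f (lpOne μ)) (lpTmul f (lpOne μ) + lpTmul (lpOne μ) f) = 0 := by
      rw [h2, inner_zero_right]
    rw [inner_add_right, inner_lpTmul, inner_lpTmul, inner_lpOne_self,
      mem_L2Zero_iff'.1 hf, zero_mul, add_zero, mul_one] at h3
    exact hf0 (inner_self_eq_zero.1 h3)

end Z2Action

end Splitting

end

/-! ### Assembly: generating pairs for both squares and splitting of the commutant -/

theorem mainTheorem2 {X Y : Type*}
    [MeasurableSpace X] [StandardBorelSpace X] [MeasurableSpace Y] [StandardBorelSpace Y]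
    (μ : Measure X) [IsProbabilityMeasure μ] [NullSingletonClass μ]
    (ν : Measure Y) [IsProbabilityMeasure ν] [NullSingletonClass ν]
    (R : Z2Action μ) (T : Z2Action ν)
    (hErg : ((R.prod R).prod (T.prod T)).TotallyErgodic)
    (hR : R.SymmSquareHasSimpleSpectrum) (hT : T.SymmSquareHasSimpleSpectrum)
    (w u : ℕ → ℤ × ℤ) (a₁ a₂ b₁ b₂ : ℝ)
    (ha₁ : 0 < a₁) (ha₂ : 0 < a₂) (hb₁ : 0 < b₁) (hb₂ : 0 < b₂)
    (hRw : WeakOperatorTendsto (fun i => R.koopman (w i))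
      ((a₁ : ℂ) • ContinuousLinearMap.id ℂ (Lp ℂ 2 μ) + (1 - a₁ : ℂ) • constProj μ))
    (hTw : WeakOperatorTendsto (fun i => T.koopman (w i))
      ((b₁ : ℂ) • T.koopman (1, 0) + (1 - b₁ : ℂ) • constProj ν))
    (hRu : WeakOperatorTendsto (fun i => R.koopman (u i))
      ((a₂ : ℂ) • ContinuousLinearMap.id ℂ (Lp ℂ 2 μ) + (1 - a₂ : ℂ) • constProj μ))
    (hTu : WeakOperatorTendsto (fun i => T.koopman (u i))
      ((b₂ : ℂ) • T.koopman (0, 1) + (1 - b₂ : ℂ) • constProj ν)) :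
    ((R.prod R).prod (T.prod T)).HasSpectralMultiplicities {2, 4} := by
  have hfix := hErg.fixesOnlyConstants
  obtain ⟨hA, hSA⟩ := hR.exists_isGeneratingPair hfix.fst
  obtain ⟨hB, hTB⟩ := hT.exists_isGeneratingPair hfix.snd
  exact Z2Action.hasSpectralMultiplicities_prod hfix
    (fun J hJ => Z2Action.commute_opTensor_of_generators
      (Z2Action.commute_of_weak_limits ha₁ hb₁ hRw hTw hJ)
      (Z2Action.commute_of_weak_limits ha₂ hb₂ hRu hTu hJ)) hSA hTB
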